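/- **Setting.** Let $(\mathcal X,d)$ be a finite non-empty metric space, let $\lambda_x>0$ for $x\in\mathcal X$, and let $p>0$. For $S\subseteq\mathcal X$ put $\lambda(S)=\sum_{x\in S}\lambda_x$. In the *Poisson arrival model*, the waiting time until the first request at a point $x$ and the waiting times between consecutive requests at $x$ are exponential variables with parameter $\lambda_x$, and all these waiting times, over all points, are mutually independent. For $m\in\mathbb N$ let $\sigma_m=(r_1,\dots,r_m)$ be the random sequence of the first $m$ requests over the whole space, in order of arrival; write $\ell(r)\in\mathcal X$ and $t(r)$ for the location and the arrival time of a request $r$. **Problem (MPMDfp).** A feasible solution serves every request $r$ at a moment $s(r)\ge t(r)$, either by clearing it at the penalty $p$, or by matching it with another request $r'$, in which case $s(r)=s(r')$ and the connection cost $d(\ell(r),\ell(r'))$ is paid once for the pair; each request is matched at most once. The cost of the solution is the sum of the delays $s(r)-t(r)$ of all requests, of the connection costs of all matched pairs, and of the penalties of all cleared requests. $\mathrm{OPT}(\sigma)$ is the minimum cost of a feasible solution for $\sigma$. **Algorithm.** The *radius* $\rho_x$ of a point $x$ is the least $u\ge 0$ with $1/\lambda(\overline B(x,u))\le u$, where $\overline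 B(x,u)=\{y: d(x,y)\le u\}$. The algorithm $\mathrm{ALG}$ keeps a set of pending requests, initially empty. When a request $r$ arrives at $x=\ell(r)$: * if $\rho_x\ge p$: if some pending request $r'$ at a point $y$ with $\rho_y<p$ satisfies $d(x,y)\le\rho_y$, then $r$ is immediately matched with such an $r'$; otherwise $r$ is immediately cleared; * if $\rho_x<p$ (the Radius rule): if some pending $r'$ satisfies $d(x,\ell(r'))\le\rho_{\ell(r')}$, then $r$ is immediately matched with such an $r'$; otherwise, if some pending $r'$ satisfies $d(x,\ell(r'))\le\rho_{\ell(r')}+\rho_x$, then $r$ is immediately matched with any such $r'$; otherwise $r$ becomes pending. At the arrival time of the last request $r_m$, after it has been processed, the requests still pending are matched with each other arbitrarily, one of them being cleared if their number is odd. **Theorem.** However the arbitrary choices are made, $\mathrm{ALG}$ almost surely outputs a feasible solution for $\sigma_m$, for every $m$, and it achieves a ratio of expectations of $8/(1-e^{-2})$, that is, $$\limsup_{m\to\infty}\frac{\mathbb E[\mathrm{ALG}(\sigma_m)]}{\mathbb E[\mathrm{OPT}(\sigma_m)]}\;\le\;\frac{8}{1-e^{-2}},$$ where $\mathrm{ALG}(\sigma_m)$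 denotes the cost of the solution that $\mathrm{ALG}$ outputs on $\sigma_m$. -/

import Mathlib

open MeasureTheory ProbabilityTheory Filter

namespace MPMDfp

/-- A request: its location in the metric space and its arrival time. -/
structure Request (X : Type*) where
  loc : X
  time : ℝ

/-! ### Requests generated by independent exponential clocks -/

/-- The waiting times `T x k` (`T x 0` is the time until the first request at `x`, and `T x (k+1)`
the time between the consecutive requests number `k` and `k+1` at `x`) are mutually independent,
and those at the point `x` are exponential with parameter `lam x`. -/
structure IsPoissonArrival {X Ω : Type*} [MeasurableSpace Ω] (lam : X → ℝ)
    (T : X → ℕ → Ω → ℝ) (P : Measure Ω) : Prop where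
  measurable : ∀ x k, Measurable (T x k)
  law : ∀ x k, P.map (T x k) = expMeasure (lam x)
  indep : iIndepFun (fun q : X × ℕ => T q.1 q.2) P

/-- Arrival time of request number `k` (counted from `0`) at the point `x`, for waiting times `T`. -/
noncomputable def arrival {X : Type*} (T : X → ℕ → ℝ) (x : X) (k : ℕ) : ℝ :=
  ∑ i ∈ Finset.range (k + 1), T x i

/-- When `c y` requests have already arrived at each point `y`, the point of the next request: the
one whose next arrival is the earliest. (Ties have probability zero.) -/
noncomputable def nextPoint {X : Type*} [Finite X] [Nonempty X] (T : X → ℕ → ℝ) (c : X → ℕ) : X :=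
  (Finite.exists_min fun x => arrival T x (c x)).choose

open Classical in
/-- `arrived T n x`: how many of the first `n` requests, in order of arrival, are at `x`. -/
noncomputable def arrived {X : Type*} [Finite X] [Nonempty X] (T : X → ℕ → ℝ) : ℕ → X → ℕ
  | 0 => fun _ => 0
  | n + 1 => Function.update (arrived T n) (nextPoint T (arrived T n))
      (arrived T n (nextPoint T (arrived T n)) + 1)

/-- The sequence of the first `m` requests over the whole space, in order of arrival. -/
noncomputable def requests {X : Type*} [Finite X] [Nonempty X] (T : X → ℕ → ℝ) (m : ℕ) :
    Fin m → Request X := fun n =>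
  let x := nextPoint T (arrived T n)
  ⟨x, arrival T x (arrived T n x)⟩

/-! ### Solutions, their cost, and the offline optimum -/

/-- A solution for `m` requests: `partner i = some j` if `i` is matched with `j`, `partner i = none`
if `i` is cleared; `time i` is the moment at which `i` is matched or cleared. -/
structure Solution (m : ℕ) where
  partner : Fin m → Option (Fin m)
  time : Fin m → ℝ

/-- No request is served before it arrives, and the matched requests form disjoint pairs, both
members of which are served at the same moment. -/
structure Feasible {X : Type*} {m : ℕ} (σ : Fin m → Request X) (S : Solution m) : Prop where
  arrival_le : ∀ i, (σ i).time ≤ S.time i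
  pair : ∀ i j, S.partner i = some j → j ≠ i ∧ S.partner j = some i ∧ S.time j = S.time i

/-- Total cost: the delays of all requests, the distances of all matched pairs (each pair counted
once), and the penalty `p` for every cleared request. -/
noncomputable def cost {X : Type*} [PseudoMetricSpace X] (p : ℝ) {m : ℕ}
    (σ : Fin m → Request X) (S : Solution m) : ℝ :=
  (∑ i, (S.time i - (σ i).time))
    + (∑ i, ∑ j, if i < j ∧ S.partner i = some j then dist (σ i).loc (σ j).loc else 0)
    + ∑ i, if S.partner i = none then p else 0

/-- The cost of an optimal offline solution. -/
noncomputable def opt {X : Type*} [PseudoMetricSpace X] (p : ℝ) {m : ℕ}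
    (σ : Fin m → Request X) : ℝ :=
  sInf (cost p σ '' {S | Feasible σ S})

/-! ### The algorithm -/

/-- `lam(S)`, the sum of `lam y` over the points `y` of `S`. -/
noncomputable def rate {X : Type*} [Fintype X] (lam : X → ℝ) (S : Set X) : ℝ :=
  ∑ y, S.indicator lam y

/-- The radius of `x`: the least `u ≥ 0` with `1 / lam(closedBall x u) ≤ u`. -/
noncomputable def radius {X : Type*} [PseudoMetricSpace X] [Fintype X] (lam : X → ℝ) (x : X) : ℝ :=
  sInf {u : ℝ | 0 ≤ u ∧ 1 / rate lam (Metric.closedBall x u) ≤ u}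

/-- State of the algorithm: the pending requests, and the decisions taken so far (the values of
`partner` and `time` at requests that are pending or have not arrived are irrelevant). -/
structure State (m : ℕ) extends Solution m where
  pending : Finset (Fin m)

namespace State

/-- Nothing has happened yet. -/
def start (m : ℕ) : State m where
  partner := fun _ => none
  time := fun _ => 0
  pending := ∅

/-- The arriving request `i` is matched with the pending request `j` at time `t`. -/
def pairUp {m : ℕ} (s : State m) (i j : Fin m) (t : ℝ) : State m where
  partner := Function.update (Function.update s.partner i (some j)) j (some i)
  time := Function.update (Function.update s.time i t) j t
  pending := s.pending.erase j

/-- The arriving request `i` is cleared at time `t`. -/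
def clear {m : ℕ} (s : State m) (i : Fin m) (t : ℝ) : State m where
  partner := Function.update s.partner i none
  time := Function.update s.time i t
  pending := s.pending

/-- The arriving request `i` becomes pending. -/
def wait {m : ℕ} (s : State m) (i : Fin m) : State m where
  partner := s.partner
  time := s.time
  pending := insert i s.pending

end State

section Algorithm

variable {X : Type*} [PseudoMetricSpace X] [Fintype X]

/-- `Step p lam σ i s s'`: on the arrival of request `i` in state `s`, the algorithm may pass to
state `s'`. The rules `high_*` are for points of radius at least `p`; the rules `low_*` are those of
the Radius algorithm. Where several requests are eligible, any of them may be taken. -/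
inductive Step (p : ℝ) (lam : X → ℝ) {m : ℕ} (σ : Fin m → Request X) (i : Fin m) (s : State m) :
    State m → Prop
  | high_match (j : Fin m) (hi : p ≤ radius lam (σ i).loc) (hj : j ∈ s.pending)
      (hjp : radius lam (σ j).loc < p)
      (hij : dist (σ i).loc (σ j).loc ≤ radius lam (σ j).loc) :
      Step p lam σ i s (s.pairUp i j (σ i).time)
  | high_clear (hi : p ≤ radius lam (σ i).loc)
      (hno : ∀ k ∈ s.pending, radius lam (σ k).loc < p →
        ¬ dist (σ i).loc (σ k).loc ≤ radius lam (σ k).loc) :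
      Step p lam σ i s (s.clear i (σ i).time)
  | low_ball (j : Fin m) (hi : radius lam (σ i).loc < p) (hj : j ∈ s.pending)
      (hij : dist (σ i).loc (σ j).loc ≤ radius lam (σ j).loc) :
      Step p lam σ i s (s.pairUp i j (σ i).time)
  | low_overlap (j : Fin m) (hi : radius lam (σ i).loc < p)
      (hno : ∀ k ∈ s.pending, ¬ dist (σ i).loc (σ k).loc ≤ radius lam (σ k).loc)
      (hj : j ∈ s.pending)
      (hij : dist (σ i).loc (σ j).loc ≤ radius lam (σ j).loc + radius lam (σ i).loc) :
      Step p lam σ i s (s.pairUp i j (σ i).time)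
  | low_wait (hi : radius lam (σ i).loc < p)
      (hno : ∀ k ∈ s.pending, ¬ dist (σ i).loc (σ k).loc ≤ radius lam (σ k).loc)
      (hno' : ∀ k ∈ s.pending,
        ¬ dist (σ i).loc (σ k).loc ≤ radius lam (σ k).loc + radius lam (σ i).loc) :
      Step p lam σ i s (s.wait i)

/-- `Reaches p lam σ n s`: after processing the first `n` requests the algorithm may be in
state `s`. -/
inductive Reaches (p : ℝ) (lam : X → ℝ) {m : ℕ} (σ : Fin m → Request X) : ℕ → State m → Prop
  | start : Reaches p lam σ 0 (State.start m)
  | step {s s' : State m} (i : Fin m) (hs : Reaches p lam σ (i : ℕ) s)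
      (h : Step p lam σ i s s') : Reaches p lam σ ((i : ℕ) + 1) s'

/-- The final phase, at the arrival time of the last request: the requests that are still pending
are matched among themselves arbitrarily, one of them being cleared if their number is odd; all
earlier decisions are kept. -/
structure Finish {m : ℕ} (σ : Fin m → Request X) (s : State m) (S : Solution m) : Prop where
  partner_eq : ∀ i, i ∉ s.pending → S.partner i = s.partner i
  time_eq : ∀ i, i ∉ s.pending → S.time i = s.time i
  late_time : ∀ i ∈ s.pending, ∀ l : Fin m, (l : ℕ) + 1 = m → S.time i = (σ l).time
  late_pair : ∀ i ∈ s.pending, ∀ j, S.partner i = some j →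
    j ∈ s.pending ∧ j ≠ i ∧ S.partner j = some i
  late_clear : {i ∈ s.pending | S.partner i = none}.card = s.pending.card % 2

/-- `S` is a solution that the algorithm, with penalty `p` and arrival rates `lam`, may output on
the request sequence `σ`, for some way of making its arbitrary choices. -/
def IsOutput (p : ℝ) (lam : X → ℝ) {m : ℕ} (σ : Fin m → Request X) (S : Solution m) : Prop :=
  ∃ s : State m, Reaches p lam σ m s ∧ Finish σ s S

end Algorithm

end MPMDfp

/-! Put `q x = min p (radius lam x)`. On average `ALG` pays at most `2 * q x` for a request at `x`,
while every solution pays on average at least `(1 - exp (-2)) / 4 * q x` for it. The quotient of the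
two constants is `8 / (1 - exp (-2))`.

Upper bound. The balls around pending requests are disjoint, so an arrival hits at most one of them,
and that one is then served (`Invariant`). Hence a request at a point of radius below `p` waits no
longer than until the next arrival in its closed ball, on average at most `1 / lam(ball) ≤ radius`;
other requests never wait. Matched points are at distance at most `q x + q y`, so each request bears
`q` of the connection cost, and clearing costs `p = q x` exactly where it happens. The final phase
costs a constant, because at most one request per point is pending (`IsOutput.cost_le`,
`IsOutput.cost_le_sum`).

Lower bound. A matched pair costs at least its time difference plus its distance. So a request can
be charged half of the time to the nearest other request in the open ball of radius `q x`, capped at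
`q x` (`sum_nearGap_le_opt`). That ball has rate at most `1 / q x`, so for `u ≤ q x` nothing else
arrives within `u` on either side with probability at least `exp (-2 * u / q x)`; integrate over `u`
(`le_lintegral_nearGap`).

From one request to `m`. The number of requests at `x` among the first `m` is asymptotic to `m * lam
x / ∑ y, lam y` (`tendsto_arrived_div`). This number depends on the gaps being summed; it is
replaced by a deterministic one, with an error controlled by convergence in mean and by a uniform
tail bound (`eventually_lintegral_sum_le`, `eventually_le_lintegral_sum`). Neither `ALG` nor `opt`
need be measurable: they are only compared pointwise with measurable sums. -/

namespace MPMDfp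

/-! ### Merging the clocks into one request sequence -/

section RequestSequence

variable {X : Type*}

lemma arrival_succ (T : X → ℕ → ℝ) (x : X) (k : ℕ) :
    arrival T x (k + 1) = arrival T x k + T x (k + 1) := by
  simp [arrival, Finset.sum_range_succ]

lemma arrival_mono {T : X → ℕ → ℝ} (hT : ∀ x k, 0 ≤ T x k) (x : X) : Monotone (arrival T x) :=
  monotone_nat_of_le_succ fun k => by
    rw [arrival_succ]; linarith [hT x (k + 1)]

lemma arrival_nonneg {T : X → ℕ → ℝ} (hT : ∀ x k, 0 ≤ T x k) (x : X) (k : ℕ) :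
    0 ≤ arrival T x k :=
  Finset.sum_nonneg fun i _ => hT x i

lemma arrival_add_le {T : X → ℕ → ℝ} (hT : ∀ x k, 0 ≤ T x k) (x : X) {k l : ℕ} (h : k < l) :
    arrival T x k + T x (k + 1) ≤ arrival T x l := by
  rw [← arrival_succ]; exact arrival_mono hT x h

lemma arrival_le_sub {T : X → ℕ → ℝ} (hT : ∀ x k, 0 ≤ T x k) (x : X) {k l : ℕ} (h : l < k) :
    arrival T x l ≤ arrival T x k - T x k := by
  obtain ⟨k, rfl⟩ : ∃ j, k = j + 1 := ⟨k - 1, by omega⟩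
  rw [arrival_succ]
  linarith [arrival_mono hT x (Nat.lt_succ_iff.1 h)]

variable [Finite X] [Nonempty X]

/-- The location of request number `n`. -/
noncomputable def reqPoint (T : X → ℕ → ℝ) (n : ℕ) : X := nextPoint T (arrived T n)

/-- The rank of request number `n` among the requests at its location. -/
noncomputable def reqRank (T : X → ℕ → ℝ) (n : ℕ) : ℕ := arrived T n (reqPoint T n)

/-- The arrival time of request number `n`. -/
noncomputable def reqTime (T : X → ℕ → ℝ) (n : ℕ) : ℝ := arrival T (reqPoint T n) (reqRank T n)

lemma requests_loc (T : X → ℕ → ℝ) (m : ℕ) (i : Fin m) :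
    (requests T m i).loc = reqPoint T i := rfl

lemma requests_time (T : X → ℕ → ℝ) (m : ℕ) (i : Fin m) :
    (requests T m i).time = reqTime T i := rfl

lemma arrival_nextPoint_le (T : X → ℕ → ℝ) (c : X → ℕ) (y : X) :
    arrival T (nextPoint T c) (c (nextPoint T c)) ≤ arrival T y (c y) :=
  (Finite.exists_min fun x => arrival T x (c x)).choose_spec y

lemma reqTime_le (T : X → ℕ → ℝ) (n : ℕ) (y : X) : reqTime T n ≤ arrival T y (arrived T n y) :=
  arrival_nextPoint_le T _ y

lemma arrived_succ_self (T : X → ℕ → ℝ) (n : ℕ) :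
    arrived T (n + 1) (reqPoint T n) = reqRank T n + 1 := by
  simp [arrived, reqPoint, reqRank]

lemma arrived_succ_of_ne (T : X → ℕ → ℝ) (n : ℕ) {x : X} (hx : x ≠ reqPoint T n) :
    arrived T (n + 1) x = arrived T n x := by
  classical
  simp only [arrived]
  exact Function.update_of_ne hx _ _

lemma arrived_mono (T : X → ℕ → ℝ) (x : X) : Monotone fun n => arrived T n x :=
  monotone_nat_of_le_succ fun n => by
    by_cases hx : x = reqPoint T n
    · subst hx; rw [arrived_succ_self]; exact Nat.le_succ _
    · rw [arrived_succ_of_ne T n hx]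

lemma reqTime_mono {T : X → ℕ → ℝ} (hT : ∀ x k, 0 ≤ T x k) : Monotone (reqTime T) :=
  monotone_nat_of_le_succ fun n =>
    (reqTime_le T n _).trans (arrival_mono hT _ (arrived_mono T _ n.le_succ))

lemma reqRank_lt_arrived (T : X → ℕ → ℝ) {n m : ℕ} (h : n < m) :
    reqRank T n < arrived T m (reqPoint T n) := by
  have := arrived_mono T (reqPoint T n) (Nat.succ_le_of_lt h)
  simp only [Nat.succ_eq_add_one, arrived_succ_self] at this
  omega

lemma reqRank_lt_reqRank (T : X → ℕ → ℝ) {n m : ℕ} (h : n < m)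
    (hp : reqPoint T n = reqPoint T m) : reqRank T n < reqRank T m := by
  have := reqRank_lt_arrived T h
  rwa [hp] at this

/-- Counts rise by one at a time, so no rank is skipped. This turns statements about clocks into
statements about actual requests. -/
lemma exists_request_eq (T : X → ℕ → ℝ) {m k : ℕ} {x : X} (h : k < arrived T m x) :
    ∃ n < m, reqPoint T n = x ∧ reqRank T n = k := by
  induction m with
  | zero => simp [arrived] at h
  | succ m ih =>
    by_cases hk : k < arrived T m x
    · obtain ⟨n, hn, h'⟩ := ih hk
      exact ⟨n, hn.trans m.lt_succ_self, h'⟩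
    · by_cases hx : x = reqPoint T m
      · subst hx
        rw [arrived_succ_self] at h
        have : reqRank T m = arrived T m (reqPoint T m) := rfl
        exact ⟨m, m.lt_succ_self, rfl, by omega⟩
      · rw [arrived_succ_of_ne T m hx] at h
        exact absurd h hk

lemma arrival_le_reqTime {T : X → ℕ → ℝ} (hT : ∀ x k, 0 ≤ T x k) {m k : ℕ} {x : X}
    (h : k < arrived T m x) : arrival T x k ≤ reqTime T m := by
  obtain ⟨n, hn, rfl, rfl⟩ := exists_request_eq T h
  exact reqTime_mono hT hn.le

/-- Regroups a sum in order of arrival by location and rank, so that the probabilistic estimates can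
treat one fixed pair `(x, k)` at a time. -/
lemma sum_requests [Fintype X] {M : Type*} [AddCommMonoid M] (T : X → ℕ → ℝ) (f : X → ℕ → M)
    (m : ℕ) :
    ∑ n ∈ Finset.range m, f (reqPoint T n) (reqRank T n)
      = ∑ x, ∑ k ∈ Finset.range (arrived T m x), f x k := by
  classical
  induction m with
  | zero => simp [arrived]
  | succ m ih =>
    rw [Finset.sum_range_succ, ih, ← Finset.add_sum_erase _ _ (Finset.mem_univ (reqPoint T m)),
      ← Finset.add_sum_erase (a := reqPoint T m) _
        (fun x => ∑ k ∈ Finset.range (arrived T (m + 1) x), f x k) (Finset.mem_univ _),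
      arrived_succ_self, Finset.sum_range_succ]
    have : ∑ x ∈ Finset.univ.erase (reqPoint T m), ∑ k ∈ Finset.range (arrived T (m + 1) x), f x k
        = ∑ x ∈ Finset.univ.erase (reqPoint T m), ∑ k ∈ Finset.range (arrived T m x), f x k :=
      Finset.sum_congr rfl fun x hx => by
        rw [arrived_succ_of_ne T m (Finset.ne_of_mem_erase hx)]
    rw [this, reqRank, add_right_comm]

lemma sum_arrived [Fintype X] (T : X → ℕ → ℝ) (m : ℕ) : ∑ x, arrived T m x = m := by
  simpa [Finset.sum_const] using (sum_requests T (fun _ _ => (1 : ℕ)) m).symm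

lemma arrived_le (T : X → ℕ → ℝ) (m : ℕ) (x : X) : arrived T m x ≤ m := by
  have := Fintype.ofFinite X
  calc arrived T m x ≤ ∑ x, arrived T m x :=
        Finset.single_le_sum (f := fun x => arrived T m x) (fun _ _ => Nat.zero_le _)
          (Finset.mem_univ x)
    _ = m := sum_arrived T m

end RequestSequence

/-! ### Lower bounds for arbitrary feasible solutions -/

section Solutions

variable {X : Type*}

/-- Summing over the matched pairs is the same as summing over the matched requests. -/
lemma sum_pairs {m : ℕ} (P : Fin m → Option (Fin m))
    (hP : ∀ i j, P i = some j → j ≠ i ∧ P j = some i) (w : Fin m → ℝ) :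
    (∑ i, ∑ j, if i < j ∧ P i = some j then w i + w j else 0)
      = ∑ i, if P i = none then 0 else w i := by
  have h1 : (∑ i, ∑ j, if i < j ∧ P i = some j then w i + w j else 0)
      = (∑ i, ∑ j, if i < j ∧ P i = some j then w i else 0)
        + ∑ i, ∑ j, if i < j ∧ P i = some j then w j else 0 := by
    simp only [← Finset.sum_add_distrib]
    refine Finset.sum_congr rfl fun i _ => Finset.sum_congr rfl fun j _ => ?_
    split_ifs <;> simp
  have h2 : (∑ i, ∑ j, if i < j ∧ P i = some j then w j else 0)
      = ∑ i, ∑ j, if j < i ∧ P i = some j then w i else 0 := by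
    rw [Finset.sum_comm]
    refine Finset.sum_congr rfl fun i _ => Finset.sum_congr rfl fun j _ => ?_
    have : P j = some i ↔ P i = some j := ⟨fun h => (hP _ _ h).2, fun h => (hP _ _ h).2⟩
    simp only [this]
  rw [h1, h2, ← Finset.sum_add_distrib]
  refine Finset.sum_congr rfl fun i _ => ?_
  rw [← Finset.sum_add_distrib]
  cases hi : P i with
  | none => simp
  | some k =>
    have hk := (hP i k hi).1
    rw [Finset.sum_eq_single k]
    · rcases lt_or_gt_of_ne hk with h | h <;> simp [h, h.not_gt]
    · intro j _ hj
      simp [Ne.symm hj]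
    · simp

/-- Clearing every request at its arrival is feasible. -/
lemma exists_feasible {m : ℕ} (σ : Fin m → Request X) : ∃ S : Solution m, Feasible σ S :=
  ⟨⟨fun _ => none, fun i => (σ i).time⟩, fun _ => le_rfl, fun _ _ h => by simp at h⟩

variable [PseudoMetricSpace X]

/-- If `v i` is at most the penalty and at most half of what any pair containing `i` must cost,
then the sum of the `v i` bounds the cost of every feasible solution from below. -/
lemma sum_le_cost {p : ℝ} {m : ℕ} {σ : Fin m → Request X} {S : Solution m} (hS : Feasible σ S)
    {v : Fin m → ℝ} (hvp : ∀ i, v i ≤ p)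
    (hv : ∀ i j, i ≠ j →
      v i ≤ (|(σ i).time - (σ j).time| + dist (σ i).loc (σ j).loc) / 2) :
    ∑ i, v i ≤ cost p σ S := by
  have hP := fun i j h => (⟨(hS.pair i j h).1, (hS.pair i j h).2.1⟩ :
    j ≠ i ∧ S.partner j = some i)
  set D : Fin m → ℝ := fun i => S.time i - (σ i).time with hD
  have hD0 : ∀ i, 0 ≤ D i := fun i => sub_nonneg.2 (hS.arrival_le i)
  have e1 : ∑ i, v i = (∑ i, if S.partner i = none then 0 else v i)
      + ∑ i, if S.partner i = none then v i else 0 := by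
    rw [← Finset.sum_add_distrib]
    exact Finset.sum_congr rfl fun i _ => by split_ifs <;> simp
  have e2 : (∑ i, if S.partner i = none then v i else 0)
      ≤ ∑ i, if S.partner i = none then p else 0 :=
    Finset.sum_le_sum fun i _ => by split_ifs <;> simp [hvp]
  have e3 : (∑ i, if S.partner i = none then 0 else D i) ≤ ∑ i, D i :=
    Finset.sum_le_sum fun i _ => by split_ifs <;> simp [hD0]
  have e4 : (∑ i, ∑ j, if i < j ∧ S.partner i = some j then v i + v j else 0)
      ≤ (∑ i, ∑ j, if i < j ∧ S.partner i = some j then D i + D j else 0)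
        + ∑ i, ∑ j, if i < j ∧ S.partner i = some j then dist (σ i).loc (σ j).loc else 0 := by
    simp only [← Finset.sum_add_distrib]
    refine Finset.sum_le_sum fun i _ => Finset.sum_le_sum fun j _ => ?_
    split_ifs with h
    · have h1 := hv i j h.1.ne
      have h2 := hv j i h.1.ne'
      rw [abs_sub_comm, dist_comm] at h2
      have h3 := (hS.pair i j h.2).2.2
      -- Both are served at one moment, no earlier than either arrival, so the earlier of the two
      -- waits at least the time difference.
      have h4 : |(σ i).time - (σ j).time| ≤ D i + D j := by
        have := hD0 i
        have := hD0 j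
        simp only [hD] at *
        rw [abs_le]; constructor <;> linarith
      linarith
    · simp
  rw [sum_pairs _ hP, sum_pairs _ hP] at e4
  rw [cost, e1]
  linarith

lemma sum_le_opt {p : ℝ} {m : ℕ} {σ : Fin m → Request X} {v : Fin m → ℝ} (hvp : ∀ i, v i ≤ p)
    (hv : ∀ i j, i ≠ j →
      v i ≤ (|(σ i).time - (σ j).time| + dist (σ i).loc (σ j).loc) / 2) :
    ∑ i, v i ≤ opt p σ := by
  obtain ⟨S, hS⟩ := exists_feasible σ
  refine le_csInf ⟨_, S, hS, rfl⟩ ?_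
  rintro _ ⟨S', hS', rfl⟩
  exact sum_le_cost hS' hvp hv

end Solutions

/-! ### Total rates of sets of points -/

section Rate

variable {X : Type*} [Fintype X] {lam : X → ℝ}

lemma rate_mono (hlam : ∀ x, 0 < lam x) {S S' : Set X} (h : S ⊆ S') : rate lam S ≤ rate lam S' :=
  Finset.sum_le_sum fun y _ => Set.indicator_le_indicator_of_subset h (fun y => (hlam y).le) y

lemma rate_eq_sum (lam : X → ℝ) (S : Set X) [DecidablePred (· ∈ S)] :
    rate lam S = ∑ y with y ∈ S, lam y := by
  rw [rate, Finset.sum_filter]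
  exact Finset.sum_congr rfl fun y _ => by simp [Set.indicator_apply]

lemma le_rate (hlam : ∀ x, 0 < lam x) {S : Set X} {x : X} (hx : x ∈ S) : lam x ≤ rate lam S := by
  rw [rate]
  calc lam x = S.indicator lam x := by simp [hx]
    _ ≤ _ := Finset.single_le_sum (f := fun y => S.indicator lam y)
      (fun y _ => Set.indicator_nonneg (fun y _ => (hlam y).le) y) (Finset.mem_univ x)

lemma rate_pos (hlam : ∀ x, 0 < lam x) {S : Set X} {x : X} (hx : x ∈ S) : 0 < rate lam S :=
  (hlam x).trans_le (le_rate hlam hx)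

end Rate

/-! ### The radius balances ball size against waiting time -/

section Radius

variable {X : Type*} [PseudoMetricSpace X] [Fintype X] {lam : X → ℝ}

lemma radius_nonneg (lam : X → ℝ) (x : X) : 0 ≤ radius lam x :=
  Real.sInf_nonneg fun _ h => h.1

lemma radius_set_nonempty (hlam : ∀ x, 0 < lam x) (x : X) :
    {u : ℝ | 0 ≤ u ∧ 1 / rate lam (Metric.closedBall x u) ≤ u}.Nonempty := by
  have h0 : 0 ≤ 1 / lam x := by have := hlam x; positivity
  exact ⟨1 / lam x, h0, one_div_le_one_div_of_le (hlam x)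
    (le_rate hlam (Metric.mem_closedBall_self h0))⟩

lemma radius_bddBelow (lam : X → ℝ) (x : X) :
    BddBelow {u : ℝ | 0 ≤ u ∧ 1 / rate lam (Metric.closedBall x u) ≤ u} :=
  ⟨0, fun _ h => h.1⟩

lemma radius_pos (hlam : ∀ x, 0 < lam x) (x : X) : 0 < radius lam x := by
  have h0 : 0 < 1 / rate lam Set.univ := by
    have := rate_pos hlam (Set.mem_univ x); positivity
  refine h0.trans_le (le_csInf (radius_set_nonempty hlam x) fun u hu => ?_)
  refine le_trans ?_ hu.2
  exact one_div_le_one_div_of_le (rate_pos hlam (Metric.mem_closedBall_self hu.1))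
    (rate_mono hlam (Set.subset_univ _))

/-- The infimum is attained: the space is finite, so the closed ball does not change when its radius
grows slightly, and a violation at the infimum would persist to its right. -/
lemma one_div_rate_closedBall_radius_le (hlam : ∀ x, 0 < lam x) (x : X) :
    1 / rate lam (Metric.closedBall x (radius lam x)) ≤ radius lam x := by
  by_contra! h
  have hev : ∀ᶠ u in nhdsWithin (radius lam x) (Set.Ici (radius lam x)),
      u < 1 / rate lam (Metric.closedBall x (radius lam x)) ∧
        ∀ y, dist y x ≤ u → dist y x ≤ radius lam x := by
    refine nhdsWithin_le_nhds ((eventually_lt_nhds h).and (eventually_all.2 fun y => ?_))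
    by_cases hy : dist y x ≤ radius lam x
    · exact Eventually.of_forall fun _ _ => hy
    · filter_upwards [eventually_lt_nhds (not_le.1 hy)] with u hu h'
      exact absurd h' (not_le.2 hu)
  rw [eventually_iff, mem_nhdsGE_iff_exists_Ico_subset] at hev
  obtain ⟨b, hb, hsub⟩ := hev
  obtain ⟨u, hu, hub⟩ := exists_lt_of_csInf_lt (radius_set_nonempty hlam x) (show _ < b from hb)
  have hru : radius lam x ≤ u := csInf_le (radius_bddBelow lam x) hu
  obtain ⟨h1, h2⟩ := hsub ⟨hru, hub⟩
  have : Metric.closedBall x u = Metric.closedBall x (radius lam x) :=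
    Set.Subset.antisymm (fun y hy => h2 y hy) (Metric.closedBall_subset_closedBall hru)
  exact absurd hu.2 (by rw [this]; exact not_le.2 h1)

/-- Just below the radius `ρ`, a closed ball of radius `u` already contains the open ball of radius
`ρ` and violates the defining inequality, so `u ≤ 1 / rate` for the open ball; let `u` tend to `ρ`.
-/
lemma rate_ball_radius_le (hlam : ∀ x, 0 < lam x) (x : X) :
    rate lam (Metric.ball x (radius lam x)) ≤ 1 / radius lam x := by
  have hρ := radius_pos hlam x
  have hx : x ∈ Metric.ball x (radius lam x) := Metric.mem_ball_self hρ
  rw [le_one_div (rate_pos hlam hx) hρ]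
  have hev : ∀ᶠ u in nhdsWithin (radius lam x) (Set.Iio (radius lam x)),
      u ≤ 1 / rate lam (Metric.ball x (radius lam x)) := by
    have : ∀ᶠ u in nhds (radius lam x), 0 ≤ u ∧
        ∀ y, dist y x < radius lam x → dist y x ≤ u := by
      refine (eventually_ge_nhds hρ).and (eventually_all.2 fun y => ?_)
      by_cases hy : dist y x < radius lam x
      · filter_upwards [eventually_ge_nhds hy] with u hu _ using hu
      · exact Eventually.of_forall fun _ h => absurd h hy
    filter_upwards [nhdsWithin_le_nhds this, self_mem_nhdsWithin] with u hu hlt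
    have hnot : ¬ (1 / rate lam (Metric.closedBall x u) ≤ u) := fun h =>
      absurd (csInf_le (radius_bddBelow lam x) ⟨hu.1, h⟩) (not_le.2 hlt)
    refine (not_le.1 hnot).le.trans (one_div_le_one_div_of_le (rate_pos hlam hx)
      (rate_mono hlam fun y hy => hu.2 y hy))
  exact le_of_tendsto (tendsto_id.mono_left nhdsWithin_le_nhds) hev

/-- Capping at `p` shrinks the ball and enlarges the bound, so both changes go the right way. -/
lemma rate_ball_min_radius_le (hlam : ∀ x, 0 < lam x) {p : ℝ} (hp : 0 < p) (x : X) :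
    rate lam (Metric.ball x (min p (radius lam x))) ≤ 1 / min p (radius lam x) :=
  (rate_mono hlam (Metric.ball_subset_ball (min_le_right _ _))).trans
    ((rate_ball_radius_le hlam x).trans
      (one_div_le_one_div_of_le (lt_min hp (radius_pos hlam x)) (min_le_right _ _)))

end Radius

/-! ### Deterministic analysis of the algorithm -/

section AlgorithmAnalysis

variable {X : Type*} [PseudoMetricSpace X] [Fintype X]

/-- What holds of the state of the algorithm after the first `n` requests: the closed balls around
the pending requests are disjoint and have seen no later request, and a served request was served
no later than the first later arrival in its ball. -/
structure Invariant (p : ℝ) (lam : X → ℝ) {m : ℕ} (σ : Fin m → Request X) (n : ℕ)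
    (s : State m) : Prop where
  pending_lt : ∀ i ∈ s.pending, (i : ℕ) < n
  pending_low : ∀ i ∈ s.pending, radius lam (σ i).loc < p
  pending_sep : ∀ i ∈ s.pending, ∀ j ∈ s.pending, i ≠ j →
    radius lam (σ i).loc + radius lam (σ j).loc < dist (σ i).loc (σ j).loc
  pending_far : ∀ i ∈ s.pending, ∀ l : Fin m, i < l → (l : ℕ) < n →
    radius lam (σ i).loc < dist (σ l).loc (σ i).loc
  served : ∀ i : Fin m, (i : ℕ) < n → i ∉ s.pending → ∃ h : Fin m, i ≤ h ∧ (h : ℕ) < n ∧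
    s.time i = (σ h).time ∧
    (∀ l, i < l → l < h → radius lam (σ i).loc < dist (σ l).loc (σ i).loc) ∧
    (p ≤ radius lam (σ i).loc → h = i)
  cleared : ∀ i : Fin m, (i : ℕ) < n → i ∉ s.pending → s.partner i = none →
    p ≤ radius lam (σ i).loc
  paired : ∀ i : Fin m, (i : ℕ) < n → i ∉ s.pending → ∀ j, s.partner i = some j →
    (j : ℕ) < n ∧ j ∉ s.pending ∧ j ≠ i ∧ s.partner j = some i ∧ s.time j = s.time i ∧
    dist (σ i).loc (σ j).loc ≤ min p (radius lam (σ i).loc) + min p (radius lam (σ j).loc)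

variable {p : ℝ} {lam : X → ℝ} {m : ℕ} {σ : Fin m → Request X}

/-- Shared by all the matching rules. The arrival may lie in the ball of `j`, which leaves the
pending set; `hfar` keeps it out of the balls that remain. -/
lemma Invariant.pairUp {i : Fin m} {s : State m} (H : Invariant p lam σ i s) {j : Fin m}
    (hj : j ∈ s.pending)
    (hd : dist (σ i).loc (σ j).loc
      ≤ min p (radius lam (σ i).loc) + min p (radius lam (σ j).loc))
    (hfar : ∀ k ∈ s.pending, k ≠ j → radius lam (σ k).loc < dist (σ i).loc (σ k).loc) :
    Invariant p lam σ (i + 1) (s.pairUp i j (σ i).time) := by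
  have hji : (j : ℕ) < i := H.pending_lt j hj
  have hne : j ≠ i := fun h => by simp [h] at hji
  have hip : i ∉ s.pending := fun h => lt_irrefl _ (H.pending_lt i h)
  have hlt : ∀ k : Fin m, (k : ℕ) < i + 1 → k ≠ i → (k : ℕ) < i := fun k hk hki =>
    lt_of_le_of_ne (Nat.lt_succ_iff.1 hk) fun h => hki (Fin.ext h)
  refine ⟨?_, ?_, ?_, ?_, ?_, ?_, ?_⟩
  · intro k hk
    exact (H.pending_lt k (Finset.mem_of_mem_erase hk)).trans (Nat.lt_succ_self _)
  · intro k hk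
    exact H.pending_low k (Finset.mem_of_mem_erase hk)
  · intro k hk l hl
    exact H.pending_sep k (Finset.mem_of_mem_erase hk) l (Finset.mem_of_mem_erase hl)
  · intro k hk l hkl hl
    by_cases hli : l = i
    · subst hli
      exact hfar k (Finset.mem_of_mem_erase hk) (Finset.ne_of_mem_erase hk)
    · exact H.pending_far k (Finset.mem_of_mem_erase hk) l hkl (hlt l hl hli)
  · intro k hk hkp
    by_cases hkj : k = j
    · subst hkj
      -- The request that was pending is served by the arrival `i`; by `pending_far` nothing between
      -- them entered its ball.
      refine ⟨i, hji.le, Nat.lt_succ_self _, by simp [State.pairUp], ?_, fun h =>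
        absurd (H.pending_low k hj) (not_lt.2 h)⟩
      exact fun l h1 h2 => H.pending_far k hj l h1 h2
    by_cases hki : k = i
    · subst hki
      exact ⟨k, le_rfl, Nat.lt_succ_self _, by simp [State.pairUp, hkj],
        fun l h1 h2 => absurd h1 h2.not_gt, fun _ => rfl⟩
    · obtain ⟨h, h1, h2, h3, h4⟩ := H.served k (hlt k hk hki) fun h =>
        hkp (Finset.mem_erase.2 ⟨hkj, h⟩)
      exact ⟨h, h1, h2.trans (Nat.lt_succ_self _), by simp [State.pairUp, hkj, hki, h3], h4⟩
  · intro k hk hkp hnone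
    by_cases hkj : k = j
    · subst hkj; simp [State.pairUp] at hnone
    by_cases hki : k = i
    · subst hki; simp [State.pairUp, hkj] at hnone
    · refine H.cleared k (hlt k hk hki) (fun h => hkp (Finset.mem_erase.2 ⟨hkj, h⟩)) ?_
      simpa [State.pairUp, hkj, hki] using hnone
  · intro k hk hkp l hl
    by_cases hkj : k = j
    · subst hkj
      obtain rfl : i = l := by simpa [State.pairUp] using hl
      refine ⟨Nat.lt_succ_self _, fun h => hip (Finset.mem_of_mem_erase h), hne.symm, ?_, ?_, ?_⟩
      · simp [State.pairUp, hne.symm]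
      · simp [State.pairUp, hne.symm]
      · rw [dist_comm, add_comm]; exact hd
    by_cases hki : k = i
    · subst hki
      obtain rfl : j = l := by simpa [State.pairUp, hkj] using hl
      refine ⟨hji.trans (Nat.lt_succ_self _), by simp [State.pairUp], hne, ?_, ?_, hd⟩
      · simp [State.pairUp]
      · simp [State.pairUp, hkj]
    · obtain ⟨h1, h2, h3, h4, h5, h6⟩ := H.paired k (hlt k hk hki)
        (fun h => hkp (Finset.mem_erase.2 ⟨hkj, h⟩)) l
        (by simpa [State.pairUp, hkj, hki] using hl)
      have hli : l ≠ i := fun h => by simp [h] at h1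
      have hlj : l ≠ j := fun h => h2 (h ▸ hj)
      refine ⟨h1.trans (Nat.lt_succ_self _), fun h => h2 (Finset.mem_of_mem_erase h), h3, ?_, ?_,
        h6⟩
      · simpa [State.pairUp, hlj, hli] using h4
      · simpa [State.pairUp, hlj, hli, hkj, hki] using h5

lemma Invariant.clear {i : Fin m} {s : State m} (H : Invariant p lam σ i s)
    (hi : p ≤ radius lam (σ i).loc)
    (hfar : ∀ k ∈ s.pending, radius lam (σ k).loc < dist (σ i).loc (σ k).loc) :
    Invariant p lam σ (i + 1) (s.clear i (σ i).time) := by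
  have hip : i ∉ s.pending := fun h => lt_irrefl _ (H.pending_lt i h)
  have hlt : ∀ k : Fin m, (k : ℕ) < i + 1 → k ≠ i → (k : ℕ) < i := fun k hk hki =>
    lt_of_le_of_ne (Nat.lt_succ_iff.1 hk) fun h => hki (Fin.ext h)
  refine ⟨fun k hk => (H.pending_lt k hk).trans (Nat.lt_succ_self _), H.pending_low,
    H.pending_sep, ?_, ?_, ?_, ?_⟩
  · intro k hk l hkl hl
    by_cases hli : l = i
    · subst hli
      exact hfar k hk
    · exact H.pending_far k hk l hkl (hlt l hl hli)
  · intro k hk hkp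
    by_cases hki : k = i
    · subst hki
      exact ⟨k, le_rfl, Nat.lt_succ_self _, by simp [State.clear],
        fun l h1 h2 => absurd h1 h2.not_gt, fun _ => rfl⟩
    · obtain ⟨h, h1, h2, h3, h4⟩ := H.served k (hlt k hk hki) hkp
      exact ⟨h, h1, h2.trans (Nat.lt_succ_self _), by simp [State.clear, hki, h3], h4⟩
  · intro k hk hkp hnone
    by_cases hki : k = i
    · subst hki; exact hi
    · exact H.cleared k (hlt k hk hki) hkp (by simpa [State.clear, hki] using hnone)
  · intro k hk hkp l hl
    by_cases hki : k = i
    · subst hki; simp [State.clear] at hl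
    · obtain ⟨h1, h2, h3, h4, h5, h6⟩ := H.paired k (hlt k hk hki) hkp l
        (by simpa [State.clear, hki] using hl)
      have hli : l ≠ i := fun h => by simp [h] at h1
      refine ⟨h1.trans (Nat.lt_succ_self _), h2, h3, ?_, ?_, h6⟩
      · simpa [State.clear, hli] using h4
      · simpa [State.clear, hli, hki] using h5

lemma Invariant.wait {i : Fin m} {s : State m} (H : Invariant p lam σ i s)
    (hi : radius lam (σ i).loc < p)
    (hfar : ∀ k ∈ s.pending, radius lam (σ k).loc < dist (σ i).loc (σ k).loc)
    (hsep : ∀ k ∈ s.pending,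
      radius lam (σ k).loc + radius lam (σ i).loc < dist (σ i).loc (σ k).loc) :
    Invariant p lam σ (i + 1) (s.wait i) := by
  have hlt : ∀ k : Fin m, (k : ℕ) < i + 1 → k ≠ i → (k : ℕ) < i := fun k hk hki =>
    lt_of_le_of_ne (Nat.lt_succ_iff.1 hk) fun h => hki (Fin.ext h)
  have hmem : ∀ k, k ∈ (s.wait i).pending ↔ k = i ∨ k ∈ s.pending := fun k => Finset.mem_insert
  refine ⟨?_, ?_, ?_, ?_, ?_, ?_, ?_⟩
  · intro k hk
    rcases (hmem k).1 hk with rfl | hk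
    · exact Nat.lt_succ_self _
    · exact (H.pending_lt k hk).trans (Nat.lt_succ_self _)
  · intro k hk
    rcases (hmem k).1 hk with rfl | hk
    · exact hi
    · exact H.pending_low k hk
  · intro k hk l hl hkl
    rcases (hmem k).1 hk with rfl | hk' <;> rcases (hmem l).1 hl with rfl | hl'
    · exact absurd rfl hkl
    · rw [add_comm]; exact hsep l hl'
    · rw [dist_comm]; exact hsep k hk'
    · exact H.pending_sep k hk' l hl' hkl
  · intro k hk l hkl hl
    rcases (hmem k).1 hk with rfl | hk'
    · have : (k : ℕ) < l := hkl
      omega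
    by_cases hli : l = i
    · subst hli
      exact hfar k hk'
    · exact H.pending_far k hk' l hkl (hlt l hl hli)
  · intro k hk hkp
    rw [hmem, not_or] at hkp
    obtain ⟨h, h1, h2, h3⟩ := H.served k (hlt k hk hkp.1) hkp.2
    exact ⟨h, h1, h2.trans (Nat.lt_succ_self _), h3⟩
  · intro k hk hkp
    rw [hmem, not_or] at hkp
    exact H.cleared k (hlt k hk hkp.1) hkp.2
  · intro k hk hkp l hl
    rw [hmem, not_or] at hkp
    obtain ⟨h1, h2, h3⟩ := H.paired k (hlt k hk hkp.1) hkp.2 l hl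
    refine ⟨h1.trans (Nat.lt_succ_self _), ?_, h3⟩
    rw [hmem, not_or]
    exact ⟨fun h => by simp [h] at h1, h2⟩

lemma Invariant.step (hp : 0 < p) {i : Fin m} {s s' : State m} (H : Invariant p lam σ i s)
    (h : Step p lam σ i s s') : Invariant p lam σ (i + 1) s' := by
  have hq : ∀ x : X, 0 ≤ min p (radius lam x) := fun x => le_min hp.le (radius_nonneg lam x)
  have key : ∀ j ∈ s.pending, dist (σ i).loc (σ j).loc ≤ radius lam (σ j).loc →
      Invariant p lam σ (i + 1) (s.pairUp i j (σ i).time) := by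
    intro j hj hij
    refine H.pairUp hj ?_ fun k hk hkj => ?_
    · rw [min_eq_right (H.pending_low j hj).le]
      linarith [hq (σ i).loc]
    -- A point within the radius of `j` cannot also be within the radius of `k`, since the two
    -- centres are farther apart than the sum of the radii.
    · have h1 := H.pending_sep k hk j hj hkj
      have h2 := dist_triangle_left (σ k).loc (σ j).loc (σ i).loc
      linarith
  cases h with
  | high_match j hi hj hjp hij => exact key j hj hij
  | high_clear hi hno => exact H.clear hi fun k hk => not_le.1 (hno k hk (H.pending_low k hk))
  | low_ball j hi hj hij => exact key j hj hij
  | low_overlap j hi hno hj hij =>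
    refine H.pairUp hj ?_ fun k hk _ => not_le.1 (hno k hk)
    rw [min_eq_right (H.pending_low j hj).le, min_eq_right hi.le]
    linarith
  | low_wait hi hno hno' =>
    exact H.wait hi (fun k hk => not_le.1 (hno k hk)) fun k hk => not_le.1 (hno' k hk)

lemma Reaches.invariant (hp : 0 < p) {n : ℕ} {s : State m} (h : Reaches p lam σ n s) :
    Invariant p lam σ n s := by
  induction h with
  | start =>
    constructor <;> simp [State.start]
  | step i _ hst ih => exact ih.step hp hst

/-- Two pending requests at one point would violate the strict separation of pending requests. This
makes the cost of the final phase bounded independently of `m`. -/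
lemma Invariant.card_pending_le {n : ℕ} {s : State m} (H : Invariant p lam σ n s) :
    s.pending.card ≤ Fintype.card X := by
  refine Finset.card_le_card_of_injOn (fun i => (σ i).loc) (fun _ _ => Finset.mem_univ _) ?_
  intro i hi j hj hij
  by_contra hne
  have h := H.pending_sep i hi j hj hne
  simp only at hij
  rw [hij, dist_self] at h
  linarith [radius_nonneg lam (σ j).loc]

/-- The final solution serves each request no later than the first later arrival in its ball. -/
lemma IsOutput.exists_time_eq (hp : 0 < p) {S : Solution m} (h : IsOutput p lam σ S)
    (i : Fin m) : ∃ h : Fin m, i ≤ h ∧ S.time i = (σ h).time ∧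
      (∀ l, i < l → l < h → radius lam (σ i).loc < dist (σ l).loc (σ i).loc) ∧
      (p ≤ radius lam (σ i).loc → h = i) := by
  obtain ⟨s, hs, hf⟩ := h
  have H := hs.invariant hp
  by_cases hi : i ∈ s.pending
  -- A request pending at the end is served with the last request, which has index `m - 1`.
  · have hm : m - 1 < m := by have := i.2; omega
    refine ⟨⟨m - 1, hm⟩, ?_, hf.late_time i hi _ ?_, fun l h1 _ => H.pending_far i hi l h1 l.2,
      fun h' => absurd (H.pending_low i hi) (not_lt.2 h')⟩
    · have := i.2
      exact Fin.mk_le_mk.2 (by omega)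
    · have := i.2
      change m - 1 + 1 = m
      omega
  · obtain ⟨h, h1, _, h2, h3⟩ := H.served i i.2 hi
    exact ⟨h, h1, (hf.time_eq i hi).trans h2, h3⟩

lemma IsOutput.feasible (hp : 0 < p) (hσ : Monotone fun i => (σ i).time) {S : Solution m}
    (h : IsOutput p lam σ S) : Feasible σ S := by
  refine ⟨fun i => ?_, ?_⟩
  · obtain ⟨k, hk, ht, -⟩ := h.exists_time_eq hp i
    rw [ht]; exact hσ hk
  · obtain ⟨s, hs, hf⟩ := h
    have H := hs.invariant hp
    intro i j hij
    by_cases hi : i ∈ s.pending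
    · obtain ⟨hj, h1, h2⟩ := hf.late_pair i hi j hij
      have hm : m - 1 < m := by have := i.2; omega
      have hm' : ((⟨m - 1, hm⟩ : Fin m) : ℕ) + 1 = m := by
        have := i.2
        change m - 1 + 1 = m
        omega
      exact ⟨h1, h2, (hf.late_time j hj _ hm').trans (hf.late_time i hi _ hm').symm⟩
    · obtain ⟨-, h2, h3, h4, h5, -⟩ := H.paired i i.2 hi j (by rw [← hf.partner_eq i hi, hij])
      exact ⟨h3, by rw [hf.partner_eq j h2, h4],
        by rw [hf.time_eq j h2, hf.time_eq i hi, h5]⟩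

/-- Each request gets a weight `w` such that a matched pair's distance is at most the sum of its two
weights and a penalty is at most the weight of the cleared request. Requests pending at the end
receive an extra `M + p`, enough for either outcome of the final phase. -/
lemma IsOutput.cost_le (hp : 0 < p) (hσ : Monotone fun i => (σ i).time) {S : Solution m}
    (h : IsOutput p lam σ S) {M : ℝ} (hM : ∀ x y : X, dist x y ≤ M) (hM0 : 0 ≤ M) :
    cost p σ S ≤ ∑ i, ((S.time i - (σ i).time) + min p (radius lam (σ i).loc))
      + Fintype.card X * (M + p) := by
  have hF := h.feasible hp hσ
  obtain ⟨s, hs, hf⟩ := h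
  have H := hs.invariant hp
  have hq : ∀ x : X, 0 ≤ min p (radius lam x) := fun x => le_min hp.le (radius_nonneg lam x)
  set w : Fin m → ℝ := fun i =>
    min p (radius lam (σ i).loc) + if i ∈ s.pending then M + p else 0 with hw
  have hwq : ∀ i, min p (radius lam (σ i).loc) ≤ w i := fun i => by
    simp only [hw]; split_ifs <;> linarith
  have hwp : ∀ i ∈ s.pending, M + p ≤ w i := fun i hi => by
    simp only [hw, hi, if_true]; linarith [hq (σ i).loc]
  have hw0 : ∀ i, 0 ≤ w i := fun i => (hq _).trans (hwq i)
  have e1 : (∑ i, ∑ j, if i < j ∧ S.partner i = some j then dist (σ i).loc (σ j).loc else 0)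
      ≤ ∑ i, ∑ j, if i < j ∧ S.partner i = some j then w i + w j else 0 := by
    refine Finset.sum_le_sum fun i _ => Finset.sum_le_sum fun j _ => ?_
    split_ifs with hij
    · by_cases hi : i ∈ s.pending
      · linarith [hM (σ i).loc (σ j).loc, hwp i hi, hw0 j]
      · have := (H.paired i i.2 hi j (by rw [← hf.partner_eq i hi, hij.2])).2.2.2.2.2
        linarith [hwq i, hwq j]
    · exact le_rfl
  rw [sum_pairs S.partner fun i j hij => ⟨(hF.pair i j hij).1, (hF.pair i j hij).2.1⟩] at e1
  have e2 : (∑ i, if S.partner i = none then p else 0)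
      ≤ ∑ i, if S.partner i = none then w i else 0 := by
    refine Finset.sum_le_sum fun i _ => ?_
    split_ifs with hn
    · by_cases hi : i ∈ s.pending
      · linarith [hwp i hi]
      · have := H.cleared i i.2 hi (by rw [← hf.partner_eq i hi, hn])
        have h2 := hwq i
        rwa [min_eq_left this] at h2
    · exact le_rfl
  have e3 : (∑ i, if S.partner i = none then 0 else w i)
      + (∑ i, if S.partner i = none then w i else 0) = ∑ i, w i := by
    rw [← Finset.sum_add_distrib]
    exact Finset.sum_congr rfl fun i _ => by split_ifs <;> simp
  have e4 : ∑ i, w i ≤ ∑ i, min p (radius lam (σ i).loc) + Fintype.card X * (M + p) := by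
    simp only [hw, Finset.sum_add_distrib, Finset.sum_ite_mem, Finset.univ_inter,
      Finset.sum_const, nsmul_eq_mul]
    have : (s.pending.card : ℝ) ≤ Fintype.card X := by exact_mod_cast H.card_pending_le
    have := mul_le_mul_of_nonneg_right this (by linarith : 0 ≤ M + p)
    linarith
  rw [cost, Finset.sum_add_distrib]
  linarith

end AlgorithmAnalysis

/-! ### Waiting time to the next and to the nearest request in a set -/

section Gaps

variable {X : Type*}

open Classical in
/-- The time from request number `k` at `x` until the next request in `B` (where `x ∈ B`). -/
noncomputable def forwardGap (T : X → ℕ → ℝ) (B : Set X) (x : X) (k : ℕ) : ℝ :=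
  ⨅ z : X × ℕ, if z.1 ∈ B ∧ arrival T x k < arrival T z.1 z.2
    then arrival T z.1 z.2 - arrival T x k else |T x (k + 1)|

open Classical in
/-- The time between request number `k` at `x` and the closest other request in `B`, capped
at `q`. -/
noncomputable def nearGap (T : X → ℕ → ℝ) (B : Set X) (q : ℝ) (x : X) (k : ℕ) : ℝ :=
  ⨅ z : X × ℕ, if z.1 ∈ B ∧ z ≠ (x, k)
    then min q |arrival T z.1 z.2 - arrival T x k| else q

lemma forwardGap_bddBelow (T : X → ℕ → ℝ) (B : Set X) (x : X) (k : ℕ) :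
    BddBelow (Set.range fun z : X × ℕ => open Classical in
      if z.1 ∈ B ∧ arrival T x k < arrival T z.1 z.2
        then arrival T z.1 z.2 - arrival T x k else |T x (k + 1)|) := by
  refine ⟨0, ?_⟩
  rintro _ ⟨z, rfl⟩
  dsimp only
  split_ifs with h
  · linarith [h.2]
  · exact abs_nonneg _

lemma forwardGap_nonneg (T : X → ℕ → ℝ) (B : Set X) (x : X) (k : ℕ) :
    0 ≤ forwardGap T B x k := by
  refine Real.iInf_nonneg fun z => ?_
  split_ifs with h
  · linarith [h.2]
  · exact abs_nonneg _

lemma forwardGap_le (T : X → ℕ → ℝ) {B : Set X} (x : X) (k : ℕ) {y : X} (hy : y ∈ B) {l : ℕ}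
    (h : arrival T x k < arrival T y l) :
    forwardGap T B x k ≤ arrival T y l - arrival T x k := by
  refine (ciInf_le (forwardGap_bddBelow T B x k) (y, l)).trans ?_
  rw [if_pos ⟨hy, h⟩]

lemma forwardGap_le_wait {T : X → ℕ → ℝ} (hT : ∀ x k, 0 < T x k) {B : Set X} {x : X}
    (hx : x ∈ B) (k : ℕ) : forwardGap T B x k ≤ T x (k + 1) := by
  have := arrival_succ T x k
  have h2 := forwardGap_le T x k hx (l := k + 1) (by linarith [hT x (k + 1)])
  linarith

lemma le_forwardGap {T : X → ℕ → ℝ} (hT : ∀ x k, 0 < T x k) {B : Set X} {x : X} (hx : x ∈ B)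
    {k : ℕ} {c : ℝ}
    (h : ∀ y ∈ B, ∀ l, arrival T x k < arrival T y l → c ≤ arrival T y l - arrival T x k) :
    c ≤ forwardGap T B x k := by
  have : Nonempty (X × ℕ) := ⟨(x, k)⟩
  refine le_ciInf fun z => ?_
  split_ifs with hz
  · exact h z.1 hz.1 z.2 hz.2
  -- Excluded indices contribute `|T x (k + 1)|`. As `x ∈ B` and waits are positive, this is the gap
  -- to the next request at `x`, already among the admissible values, so the default does not lower
  -- the infimum.
  · have h1 := arrival_succ T x k
    have h2 := h x hx (k + 1) (by linarith [hT x (k + 1)])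
    rw [abs_of_pos (hT x (k + 1))]
    linarith

lemma nearGap_bddBelow (T : X → ℕ → ℝ) (B : Set X) {q : ℝ} (hq : 0 ≤ q) (x : X) (k : ℕ) :
    BddBelow (Set.range fun z : X × ℕ => open Classical in
      if z.1 ∈ B ∧ z ≠ (x, k) then min q |arrival T z.1 z.2 - arrival T x k| else q) := by
  refine ⟨0, ?_⟩
  rintro _ ⟨z, rfl⟩
  dsimp only
  split_ifs
  · exact le_min hq (abs_nonneg _)
  · exact hq

lemma nearGap_nonneg (T : X → ℕ → ℝ) (B : Set X) {q : ℝ} (hq : 0 ≤ q) (x : X) (k : ℕ) :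
    0 ≤ nearGap T B q x k := by
  refine Real.iInf_nonneg fun z => ?_
  split_ifs
  · exact le_min hq (abs_nonneg _)
  · exact hq

lemma nearGap_le (T : X → ℕ → ℝ) (B : Set X) {q : ℝ} (hq : 0 ≤ q) (x : X) (k : ℕ) :
    nearGap T B q x k ≤ q := by
  refine (ciInf_le (nearGap_bddBelow T B hq x k) (x, k)).trans ?_
  simp

lemma nearGap_le_abs (T : X → ℕ → ℝ) {B : Set X} {q : ℝ} (hq : 0 ≤ q) (x : X) (k : ℕ) {y : X}
    (hy : y ∈ B) {l : ℕ} (h : (y, l) ≠ (x, k)) :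
    nearGap T B q x k ≤ |arrival T y l - arrival T x k| := by
  refine (ciInf_le (nearGap_bddBelow T B hq x k) (y, l)).trans ?_
  rw [if_pos ⟨hy, h⟩]
  exact min_le_right _ _

lemma le_nearGap (T : X → ℕ → ℝ) {B : Set X} {q : ℝ} {x : X} {k : ℕ} {c : ℝ} (hc : c ≤ q)
    (h : ∀ y ∈ B, ∀ l, (y, l) ≠ (x, k) → c ≤ |arrival T y l - arrival T x k|) :
    c ≤ nearGap T B q x k := by
  have : Nonempty (X × ℕ) := ⟨(x, k)⟩
  refine le_ciInf fun z => ?_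
  split_ifs with hz
  · exact le_min hc (h z.1 hz.1 z.2 hz.2)
  · exact hc

end Gaps

/-! ### Costs bounded by gaps for each realisation -/

section PathwiseBounds

lemma monotone_requests_time {X : Type*} [Finite X] [Nonempty X] {T : X → ℕ → ℝ} {m : ℕ}
    (hT : ∀ x k, 0 < T x k) :
    Monotone fun i => (requests T m i).time := fun i j hij =>
  reqTime_mono (fun x k => (hT x k).le) (show (i : ℕ) ≤ j from hij)

variable {X : Type*} [PseudoMetricSpace X] [Fintype X] [Nonempty X] {p : ℝ} {lam : X → ℝ}
  {T : X → ℕ → ℝ} {m : ℕ}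

/-- The invariant forbids an arrival in the ball strictly between request `i` and its service; at
points of radius at least `p` service is immediate. -/
lemma IsOutput.delay_le (hp : 0 < p) (hT : ∀ x k, 0 < T x k) {S : Solution m}
    (h : IsOutput p lam (requests T m) S) (i : Fin m) :
    S.time i - reqTime T i ≤ if radius lam (reqPoint T i) < p
      then forwardGap T (Metric.closedBall (reqPoint T i) (radius lam (reqPoint T i)))
        (reqPoint T i) (reqRank T i) else 0 := by
  have hT0 : ∀ x k, 0 ≤ T x k := fun x k => (hT x k).le
  obtain ⟨h, hih, ht, hno, hhigh⟩ := h.exists_time_eq hp i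
  rw [requests_time] at ht
  split_ifs with hr
  · refine le_forwardGap hT (Metric.mem_closedBall_self (radius_nonneg _ _)) fun y hy l hl => ?_
    rw [ht]
    refine sub_le_sub_right ?_ (reqTime T i)
    -- An arrival in the ball strictly before the service time would be a request `n` with `i < n <
    -- h`, contradicting `hno`.
    by_contra! hlt
    have h1 : l < arrived T h y := by
      by_contra! hle
      exact absurd ((reqTime_le T h y).trans (arrival_mono hT0 y hle)) (not_le.2 hlt)
    obtain ⟨n, hn, rfl, rfl⟩ := exists_request_eq T h1
    have hin : (i : ℕ) < n := by
      by_contra! hle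
      exact absurd (reqTime_mono hT0 hle) (not_le.2 hl)
    have := hno ⟨n, hn.trans h.2⟩ hin hn
    rw [requests_loc, requests_loc] at this
    exact absurd (Metric.mem_closedBall.1 hy) (not_le.2 this)
  · have := hhigh (not_lt.1 hr)
    rw [ht, this, sub_self]

/-- Pathwise upper bound for the cost of the algorithm. -/
lemma IsOutput.cost_le_sum (hp : 0 < p) (hT : ∀ x k, 0 < T x k) {S : Solution m}
    (h : IsOutput p lam (requests T m) S) {M : ℝ} (hM : ∀ x y : X, dist x y ≤ M) (hM0 : 0 ≤ M) :
    cost p (requests T m) S ≤ (∑ x, ∑ k ∈ Finset.range (arrived T m x),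
      ((if radius lam x < p then forwardGap T (Metric.closedBall x (radius lam x)) x k else 0)
        + min p (radius lam x))) + Fintype.card X * (M + p) := by
  refine (h.cost_le hp (monotone_requests_time hT) hM hM0).trans ?_
  rw [← sum_requests T (fun x k => (if radius lam x < p then
    forwardGap T (Metric.closedBall x (radius lam x)) x k else 0) + min p (radius lam x)) m,
    ← Fin.sum_univ_eq_sum_range (fun n => (if radius lam (reqPoint T n) < p then
    forwardGap T (Metric.closedBall (reqPoint T n) (radius lam (reqPoint T n))) (reqPoint T n)
      (reqRank T n) else 0) + min p (radius lam (reqPoint T n)))]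
  gcongr with i
  · exact h.delay_le hp hT i
  · exact le_rfl

/-- Pathwise lower bound for the offline optimum. -/
lemma sum_nearGap_le_opt (hp : 0 < p) :
    (∑ x, ∑ k ∈ Finset.range (arrived T m x),
      nearGap T (Metric.ball x (min p (radius lam x))) (min p (radius lam x)) x k / 2)
      ≤ opt p (requests T m) := by
  have hq : ∀ x : X, 0 ≤ min p (radius lam x) := fun x => le_min hp.le (radius_nonneg lam x)
  rw [← sum_requests T (fun x k =>
    nearGap T (Metric.ball x (min p (radius lam x))) (min p (radius lam x)) x k / 2) m,
    ← Fin.sum_univ_eq_sum_range (fun n => nearGap T (Metric.ball (reqPoint T n)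
      (min p (radius lam (reqPoint T n)))) (min p (radius lam (reqPoint T n)))
      (reqPoint T n) (reqRank T n) / 2)]
  refine sum_le_opt (fun i => ?_) fun i j hij => ?_
  · have h1 := nearGap_le T (Metric.ball (reqPoint T i) (min p (radius lam (reqPoint T i))))
      (hq (reqPoint T i)) (reqPoint T i) (reqRank T i)
    have h2 := min_le_left p (radius lam (reqPoint T i))
    linarith
  · rw [requests_loc, requests_loc, requests_time, requests_time]
    refine div_le_div_of_nonneg_right ?_ two_pos.le
    -- Inside the open ball, `j` competes in the gap of `i` and the time difference suffices;
    -- outside, the distance alone is at least the cap.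
    by_cases hd : dist (reqPoint T i) (reqPoint T j) < min p (radius lam (reqPoint T i))
    · have hne : (reqPoint T j, reqRank T j) ≠ (reqPoint T i, reqRank T i) := by
        intro h
        rw [Prod.mk.injEq] at h
        rcases lt_or_gt_of_ne hij with hlt | hlt
        · exact (reqRank_lt_reqRank T (show (i : ℕ) < j from hlt) h.1.symm).ne h.2.symm
        · exact (reqRank_lt_reqRank T (show (j : ℕ) < i from hlt) h.1).ne h.2
      have := nearGap_le_abs T (hq (reqPoint T i)) (reqPoint T i) (reqRank T i)
        (Metric.mem_ball'.2 hd) hne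
      rw [abs_sub_comm] at this
      have h0 := dist_nonneg (x := reqPoint T i) (y := reqPoint T j)
      exact this.trans (le_add_of_nonneg_right h0)
    · have := nearGap_le T (Metric.ball (reqPoint T i) (min p (radius lam (reqPoint T i))))
        (hq (reqPoint T i)) (reqPoint T i) (reqRank T i)
      linarith [abs_nonneg (reqTime T i - reqTime T j)]

end PathwiseBounds

/-! ### A single exponential clock -/

section ExponentialClock

lemma expMeasure_Ioi {r : ℝ} (hr : 0 < r) {u : ℝ} (hu : 0 ≤ u) :
    expMeasure r (Set.Ioi u) = ENNReal.ofReal (Real.exp (-(r * u))) := by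
  have := isProbabilityMeasure_expMeasure hr
  rw [← Set.compl_Iic, prob_compl_eq_one_sub measurableSet_Iic, ← ofReal_cdf,
    cdf_expMeasure_eq hr, if_pos hu, ← ENNReal.ofReal_one,
    ← ENNReal.ofReal_sub _ (by simp [Real.exp_le_one_iff, hr.le, hu, mul_nonneg]), sub_sub_cancel]

lemma expMeasure_Iic_zero {r : ℝ} (hr : 0 < r) : expMeasure r (Set.Iic 0) = 0 := by
  have := isProbabilityMeasure_expMeasure hr
  rw [← ofReal_cdf, cdf_expMeasure_eq hr]
  simp

lemma lintegral_exp_neg_mul {r : ℝ} (hr : 0 < r) :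
    ∫⁻ t in Set.Ioi (0 : ℝ), ENNReal.ofReal (Real.exp (-(r * t))) = ENNReal.ofReal (1 / r) := by
  have hi : IntegrableOn (fun t => Real.exp (-(r * t))) (Set.Ioi 0) := by
    simpa only [neg_mul] using exp_neg_integrableOn_Ioi 0 hr
  rw [← ofReal_integral_eq_lintegral_ofReal hi (Eventually.of_forall fun _ => (Real.exp_pos _).le)]
  have := integral_exp_mul_Ioi (a := -r) (by linarith) 0
  simp only [neg_mul, mul_zero, Real.exp_zero] at this
  rw [this, neg_div_neg_eq]

/-- The layer-cake formula followed by integration of the exponential bound. -/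
lemma lintegral_le_of_tail_le {Ω : Type*} [MeasurableSpace Ω] {P : Measure Ω} {f : Ω → ℝ}
    (hf : Measurable f) (hf0 : ∀ ω, 0 ≤ f ω) {r c : ℝ} (hr : 0 < r) (hc : 0 ≤ c)
    (h : ∀ u > 0, P {ω | u < f ω} ≤ ENNReal.ofReal (c * Real.exp (-(r * u)))) :
    ∫⁻ ω, ENNReal.ofReal (f ω) ∂P ≤ ENNReal.ofReal (c / r) := by
  rw [lintegral_eq_lintegral_meas_lt P (Eventually.of_forall hf0) hf.aemeasurable]
  calc ∫⁻ t in Set.Ioi 0, P {ω | t < f ω}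
      ≤ ∫⁻ t in Set.Ioi (0 : ℝ), ENNReal.ofReal c * ENNReal.ofReal (Real.exp (-(r * t))) := by
        refine setLIntegral_mono' measurableSet_Ioi fun t ht => ?_
        rw [← ENNReal.ofReal_mul hc]
        exact h t ht
    _ = ENNReal.ofReal (c / r) := by
        rw [lintegral_const_mul _ (by fun_prop), lintegral_exp_neg_mul hr,
          ← ENNReal.ofReal_mul hc, mul_one_div]

variable {Ω : Type*} [MeasurableSpace Ω] {P : Measure Ω} {r : ℝ}

lemma measure_lt_of_map_eq_exp {V : Ω → ℝ} (hV : Measurable V) (hr : 0 < r)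
    (hlaw : P.map V = expMeasure r) {u : ℝ} (hu : 0 ≤ u) :
    P {ω | u < V ω} = ENNReal.ofReal (Real.exp (-(r * u))) := by
  rw [← expMeasure_Ioi hr hu, ← hlaw, Measure.map_apply hV measurableSet_Ioi]
  rfl

lemma ae_pos_of_map_eq_exp {V : Ω → ℝ} (hV : Measurable V) (hr : 0 < r)
    (hlaw : P.map V = expMeasure r) : ∀ᵐ ω ∂P, 0 < V ω := by
  have h := expMeasure_Iic_zero hr
  rw [← hlaw, Measure.map_apply hV measurableSet_Iic] at h
  rw [ae_iff]
  simpa [Set.preimage, not_lt] using h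

lemma lintegral_of_map_eq_exp {V : Ω → ℝ} (hV : Measurable V) (hr : 0 < r)
    (hlaw : P.map V = expMeasure r) :
    ∫⁻ ω, ENNReal.ofReal (V ω) ∂P = ENNReal.ofReal (1 / r) := by
  rw [lintegral_eq_lintegral_meas_lt P ((ae_pos_of_map_eq_exp hV hr hlaw).mono fun _ h => h.le)
    hV.aemeasurable, ← lintegral_exp_neg_mul hr]
  exact setLIntegral_congr_fun measurableSet_Ioi fun t ht =>
    measure_lt_of_map_eq_exp hV hr hlaw (le_of_lt ht)

lemma integrable_of_map_eq_exp {V : Ω → ℝ} (hV : Measurable V) (hr : 0 < r)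
    (hlaw : P.map V = expMeasure r) : Integrable V P :=
  (lintegral_ofReal_ne_top_iff_integrable hV.aestronglyMeasurable
    ((ae_pos_of_map_eq_exp hV hr hlaw).mono fun _ h => h.le)).1
    (by rw [lintegral_of_map_eq_exp hV hr hlaw]; exact ENNReal.ofReal_ne_top)

lemma integral_of_map_eq_exp {V : Ω → ℝ} (hV : Measurable V) (hr : 0 < r)
    (hlaw : P.map V = expMeasure r) : ∫ ω, V ω ∂P = 1 / r := by
  rw [integral_eq_lintegral_of_nonneg_ae ((ae_pos_of_map_eq_exp hV hr hlaw).mono fun _ h => h.le)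
    hV.aestronglyMeasurable, lintegral_of_map_eq_exp hV hr hlaw,
    ENNReal.toReal_ofReal (by positivity)]

variable {Y : ℕ → Ω → ℝ}

lemma ae_tendsto_sum_div (hY : ∀ k, Measurable (Y k)) (hr : 0 < r)
    (hlaw : ∀ k, P.map (Y k) = expMeasure r) (hind : iIndepFun Y P) :
    ∀ᵐ ω ∂P, Tendsto (fun n : ℕ => (∑ i ∈ Finset.range n, Y i ω) / n) atTop (nhds (1 / r)) := by
  have := strong_law_ae_real Y (integrable_of_map_eq_exp (hY 0) hr (hlaw 0))
    (fun i j hij => hind.indepFun hij)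
    fun i => ⟨(hY i).aemeasurable, (hY 0).aemeasurable, by rw [hlaw, hlaw]⟩
  rwa [integral_of_map_eq_exp (hY 0) hr (hlaw 0)] at this

variable [IsProbabilityMeasure P]

/-- Memorylessness. -/
lemma measure_le_lt_add {U V : Ω → ℝ} (hU : Measurable U) (hV : Measurable V) (hr : 0 < r)
    (hlaw : P.map V = expMeasure r) (hUV : IndepFun U V P) {a b : ℝ} (hab : a ≤ b) :
    P {ω | U ω ≤ a ∧ b < U ω + V ω}
      = ENNReal.ofReal (Real.exp (-(r * (b - a)))) * P {ω | U ω ≤ a ∧ a < U ω + V ω} := by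
  have key : ∀ v, a ≤ v → P {ω | U ω ≤ a ∧ v < U ω + V ω}
      = ∫⁻ u in Set.Iic a, ENNReal.ofReal (Real.exp (-(r * (v - u)))) ∂(P.map U) := by
    intro v hv
    have := isProbabilityMeasure_expMeasure hr
    have := Measure.isProbabilityMeasure_map (μ := P) hU.aemeasurable
    have hm : MeasurableSet {z : ℝ × ℝ | z.1 ≤ a ∧ v < z.1 + z.2} :=
      (measurableSet_le measurable_fst measurable_const).inter
        (measurableSet_lt measurable_const (measurable_fst.add measurable_snd))
    have e : {ω | U ω ≤ a ∧ v < U ω + V ω}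
        = (fun ω => (U ω, V ω)) ⁻¹' {z : ℝ × ℝ | z.1 ≤ a ∧ v < z.1 + z.2} := rfl
    rw [e, ← Measure.map_apply (hU.prodMk hV) hm,
      (indepFun_iff_map_prod_eq_prod_map_map hU.aemeasurable hV.aemeasurable).1 hUV, hlaw,
      Measure.prod_apply hm, ← lintegral_indicator measurableSet_Iic]
    refine lintegral_congr fun u => ?_
    by_cases hu : u ≤ a
    · rw [Set.indicator_of_mem (Set.mem_Iic.2 hu), ← expMeasure_Ioi hr (by linarith)]
      congr 1
      ext z
      simp [hu, sub_lt_iff_lt_add']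
    · rw [Set.indicator_of_notMem (by simpa using hu)]
      simp [hu]
  -- Conditionally on `U = u ≤ a`, the probabilities are `exp (-r (b - u))` and `exp (-r (a - u))`,
  -- whose ratio does not depend on `u`.
  rw [key b hab, key a le_rfl, ← lintegral_const_mul _ (by fun_prop)]
  refine lintegral_congr fun u => ?_
  rw [← ENNReal.ofReal_mul (Real.exp_pos _).le, ← Real.exp_add]
  congr 2; ring

lemma tendsto_atTop_of_tendsto_div {s : ℕ → ℝ} {c : ℝ} (hc : 0 < c)
    (h : Tendsto (fun n : ℕ => s n / n) atTop (nhds c)) : Tendsto s atTop atTop := by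
  have h2 := h.pos_mul_atTop hc tendsto_natCast_atTop_atTop
  refine h2.congr' ?_
  filter_upwards [eventually_gt_atTop 0] with n hn
  have : (n : ℝ) ≠ 0 := by positivity
  field_simp

/-- The number of arrivals of an exponential clock in `(a, b]` is zero with probability
`exp (-r (b - a))`. -/
lemma measure_no_arrival (hY : ∀ k, Measurable (Y k)) (hr : 0 < r)
    (hlaw : ∀ k, P.map (Y k) = expMeasure r) (hind : iIndepFun Y P) {a b : ℝ} (ha : 0 ≤ a)
    (hab : a ≤ b) :
    P {ω | ∀ l, ¬ (a < ∑ i ∈ Finset.range (l + 1), Y i ω ∧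
      ∑ i ∈ Finset.range (l + 1), Y i ω ≤ b)} = ENNReal.ofReal (Real.exp (-(r * (b - a)))) := by
  set s : ℕ → Ω → ℝ := fun k ω => ∑ i ∈ Finset.range k, Y i ω with hs
  have hsm : ∀ k, Measurable (s k) := fun k => Finset.measurable_sum _ fun i _ => hY i
  have hsucc : ∀ k ω, s (k + 1) ω = s k ω + Y k ω := fun k ω => Finset.sum_range_succ _ _
  have hpos : ∀ᵐ ω ∂P, ∀ k, 0 < Y k ω :=
    ae_all_iff.2 fun k => ae_pos_of_map_eq_exp (hY k) hr (hlaw k)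
  have hmono : ∀ ω, (∀ k, 0 < Y k ω) → Monotone fun k => s k ω := fun ω hω =>
    monotone_nat_of_le_succ fun k => by rw [hsucc]; linarith [hω k]
  have hindk : ∀ k, IndepFun (s k) (Y k) P := fun k => by
    have := hind.indepFun_sum_range_succ hY k
    convert this using 1
    ext ω; simp [hs]
  -- Split by the number `k` of arrivals up to time `a`: the window is empty exactly when arrival
  -- number `k`, counted from `0`, comes after `v`. Almost surely exactly one `k` is possible, since
  -- the partial sums increase to infinity.
  have key : ∀ v, a ≤ v → P {ω | ∀ l, ¬ (a < s (l + 1) ω ∧ s (l + 1) ω ≤ v)}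
      = ∑' k, P {ω | s k ω ≤ a ∧ v < s k ω + Y k ω} := by
    intro v hv
    rw [← measure_iUnion₀]
    · refine measure_congr ?_
      filter_upwards [hpos, ae_tendsto_sum_div hY hr hlaw hind] with ω hω hlim
      have htop := tendsto_atTop_of_tendsto_div (by positivity) hlim
      refine propext ⟨fun h => ?_, fun h => ?_⟩
      · have hex : ∃ k, a < s k ω := (htop.eventually_gt_atTop a).exists
        classical
        obtain ⟨k, hk⟩ : ∃ k, Nat.find hex = k + 1 := by
          refine Nat.exists_eq_succ_of_ne_zero fun h0 => ?_
          have := Nat.find_spec hex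
          rw [h0] at this
          simp [hs] at this
          linarith
        have h1 : a < s (k + 1) ω := by rw [← hk]; exact Nat.find_spec hex
        have h2 : s k ω ≤ a := not_lt.1 (Nat.find_min hex (by omega))
        have h3 : v < s (k + 1) ω := by
          by_contra! h3
          exact h k ⟨h1, h3⟩
        rw [hsucc] at h3
        exact Set.mem_iUnion.2 ⟨k, h2, h3⟩
      · obtain ⟨k, h1, h2⟩ := Set.mem_iUnion.1 h
        rintro l ⟨h3, h4⟩
        rw [← hsucc] at h2
        rcases le_or_gt k l with hkl | hkl
        · have := hmono ω hω (Nat.succ_le_succ hkl)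
          simp only [Nat.succ_eq_add_one] at this
          linarith
        · have := hmono ω hω (Nat.succ_le_of_lt hkl)
          simp only [Nat.succ_eq_add_one] at this
          linarith
    · have aux : ∀ k l, k < l → AEDisjoint P {ω | s k ω ≤ a ∧ v < s k ω + Y k ω}
          {ω | s l ω ≤ a ∧ v < s l ω + Y l ω} := by
        intro k l hkl
        refine measure_mono_null ?_ (ae_iff.1 hpos)
        rintro ω ⟨⟨_, h2⟩, ⟨h3, _⟩⟩ hω
        have := hmono ω hω (Nat.succ_le_of_lt hkl)
        simp only [Nat.succ_eq_add_one, hsucc] at this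
        linarith
      intro k l hkl
      rcases lt_or_gt_of_ne hkl with h | h
      · exact aux k l h
      · exact (aux l k h).symm
    · intro k
      exact ((measurableSet_le (hsm k) measurable_const).inter
        (measurableSet_lt measurable_const ((hsm k).add (hY k)))).nullMeasurableSet
  -- For the empty window `v = a` the same series sums to `1`. Memorylessness multiplies every term
  -- by the same factor, so the Poisson distribution itself is never needed.
  have h1 : P {ω | ∀ l, ¬ (a < s (l + 1) ω ∧ s (l + 1) ω ≤ a)} = 1 := by
    rw [show {ω | ∀ l, ¬ (a < s (l + 1) ω ∧ s (l + 1) ω ≤ a)} = Set.univ from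
      Set.eq_univ_of_forall fun ω l h => absurd h.1 (not_lt.2 h.2), measure_univ]
  rw [key a le_rfl] at h1
  rw [key b hab, ← mul_one (ENNReal.ofReal _), ← h1, ← ENNReal.tsum_mul_left]
  exact tsum_congr fun k => measure_le_lt_add (hsm k) (hY k) hr (hlaw k) (hindk k) hab

end ExponentialClock

/-! ### Independent clocks and the expected gaps -/

namespace IsPoissonArrival

variable {X Ω : Type*} [MeasurableSpace Ω] {P : Measure Ω} {lam : X → ℝ}
  {T : X → ℕ → Ω → ℝ}

lemma iIndepFun_wait (hT : IsPoissonArrival lam T P) (x : X) : iIndepFun (T x) P :=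
  hT.indep.precomp (g := fun k : ℕ => (x, k)) fun _ _ h => (Prod.mk.inj h).2

lemma measurable_clock (hT : IsPoissonArrival lam T P) (x : X) :
    Measurable fun ω k => T x k ω :=
  measurable_pi_lambda _ fun k => hT.measurable x k

lemma measurable_arrival (hT : IsPoissonArrival lam T P) (x : X) (k : ℕ) :
    Measurable fun ω => arrival (fun x k => T x k ω) x k :=
  Finset.measurable_sum _ fun i _ => hT.measurable x i

lemma ae_pos (hlam : ∀ x, 0 < lam x) [Countable X] (hT : IsPoissonArrival lam T P) :
    ∀ᵐ ω ∂P, ∀ x k, 0 < T x k ω :=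
  ae_all_iff.2 fun x => ae_all_iff.2 fun k =>
    ae_pos_of_map_eq_exp (hT.measurable x k) (hlam x) (hT.law x k)

lemma measurable_forwardGap [Countable X] (hT : IsPoissonArrival lam T P) (B : Set X) (x : X) (k : ℕ) :
    Measurable fun ω => forwardGap (fun x k => T x k ω) B x k := by
  classical
  refine Measurable.iInf fun z => ?_
  by_cases hz : z.1 ∈ B
  · simp only [hz, true_and]
    exact Measurable.ite (measurableSet_lt (hT.measurable_arrival x k)
      (hT.measurable_arrival z.1 z.2)) ((hT.measurable_arrival z.1 z.2).sub
      (hT.measurable_arrival x k)) (hT.measurable x (k + 1)).abs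
  · simp only [hz, false_and, if_false]
    exact (hT.measurable x (k + 1)).abs

lemma measurable_nearGap [Countable X] (hT : IsPoissonArrival lam T P) (B : Set X) (q : ℝ) (x : X) (k : ℕ) :
    Measurable fun ω => nearGap (fun x k => T x k ω) B q x k := by
  classical
  refine Measurable.iInf fun z => ?_
  by_cases hz : z.1 ∈ B ∧ z ≠ (x, k)
  · simp only [if_pos hz]
    exact measurable_const.min ((hT.measurable_arrival z.1 z.2).sub
      (hT.measurable_arrival x k)).abs
  · simp only [if_neg hz]
    exact measurable_const

variable [IsProbabilityMeasure P]

/-- The clocks at different points are independent. -/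
lemma iIndepFun_clock (hT : IsPoissonArrival lam T P) :
    iIndepFun (fun x ω k => T x k ω) P := by
  have hm := fun x k => hT.measurable x k
  have hprob : ∀ x k, IsProbabilityMeasure (P.map (T x k)) := fun x k =>
    Measure.isProbabilityMeasure_map (hm x k).aemeasurable
  have h1 := (iIndepFun_iff_map_fun_eq_infinitePi_map
    (fun q : X × ℕ => hm q.1 q.2)).1 hT.indep
  rw [iIndepFun_iff_map_fun_eq_infinitePi_map fun x => hT.measurable_clock x]
  have h2 : ∀ x, P.map (fun ω k => T x k ω) = Measure.infinitePi fun k => P.map (T x k) := fun x =>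
    (iIndepFun_iff_map_fun_eq_infinitePi_map (hm x)).1 (hT.iIndepFun_wait x)
  simp_rw [h2]
  -- The joint law over pairs `(x, k)` is a product measure; currying makes it a product over `x` of
  -- the laws of whole clocks.
  rw [← Measure.infinitePi_map_curry (fun x k => P.map (T x k)), ← h1]
  exact (Measure.map_map (MeasurableEquiv.measurable (MeasurableEquiv.curry X ℕ ℝ))
    (measurable_pi_lambda (fun ω (q : X × ℕ) => T q.1 q.2 ω) fun q => hm q.1 q.2)).symm

lemma measure_no_arrival_finset (hlam : ∀ x, 0 < lam x) (hT : IsPoissonArrival lam T P)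
    (S : Finset X) {a b : ℝ} (ha : 0 ≤ a) (hab : a ≤ b) :
    P {ω | ∀ y ∈ S, ∀ l, ¬ (a < ∑ i ∈ Finset.range (l + 1), T y i ω ∧
      ∑ i ∈ Finset.range (l + 1), T y i ω ≤ b)}
      = ENNReal.ofReal (Real.exp (-((∑ y ∈ S, lam y) * (b - a)))) := by
  have hset : MeasurableSet {c : ℕ → ℝ | ∀ l, ¬ (a < ∑ i ∈ Finset.range (l + 1), c i ∧
      ∑ i ∈ Finset.range (l + 1), c i ≤ b)} := by
    rw [Set.ofPred_forall]
    refine MeasurableSet.iInter fun l => MeasurableSet.compl ?_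
    have : Measurable fun c : ℕ → ℝ => ∑ i ∈ Finset.range (l + 1), c i :=
      Finset.measurable_sum _ fun i _ => measurable_pi_apply i
    exact (measurableSet_lt measurable_const this).inter (measurableSet_le this measurable_const)
  have h := hT.iIndepFun_clock.measure_inter_preimage_eq_mul S
    (sets := fun _ => {c : ℕ → ℝ | ∀ l, ¬ (a < ∑ i ∈ Finset.range (l + 1), c i ∧
      ∑ i ∈ Finset.range (l + 1), c i ≤ b)}) fun _ _ => hset
  have e : {ω | ∀ y ∈ S, ∀ l, ¬ (a < ∑ i ∈ Finset.range (l + 1), T y i ω ∧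
      ∑ i ∈ Finset.range (l + 1), T y i ω ≤ b)}
      = ⋂ y ∈ S, (fun ω k => T y k ω) ⁻¹' {c : ℕ → ℝ | ∀ l,
        ¬ (a < ∑ i ∈ Finset.range (l + 1), c i ∧ ∑ i ∈ Finset.range (l + 1), c i ≤ b)} := by
    ext ω; simp
  rw [e, h, Finset.sum_mul, ← Finset.sum_neg_distrib, Real.exp_sum,
    ENNReal.ofReal_prod_of_nonneg fun _ _ => (Real.exp_pos _).le]
  exact Finset.prod_congr rfl fun y _ =>
    measure_no_arrival (hT.measurable y) (hlam y) (hT.law y) (hT.iIndepFun_wait y) ha hab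

/-- Given the clock at `x`, the other clocks in `S` have no arrival in the window `(a, b]`, whose
ends may depend on the clock at `x`, with probability `exp (-lam(S) (b - a))`. -/
lemma measure_clock_mem_and_no_arrival (hlam : ∀ x, 0 < lam x) (hT : IsPoissonArrival lam T P)
    {x : X} {S : Finset X} (hxS : x ∉ S) {E : Set (ℕ → ℝ)} (hE : MeasurableSet E)
    {a b : (ℕ → ℝ) → ℝ} (ham : Measurable a) (hbm : Measurable b)
    (ha : ∀ c ∈ E, 0 ≤ a c) (hab : ∀ c ∈ E, a c ≤ b c) :
    P {ω | (fun k => T x k ω) ∈ E ∧ ∀ y ∈ S, ∀ l,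
      ¬ (a (fun k => T x k ω) < ∑ i ∈ Finset.range (l + 1), T y i ω ∧
        ∑ i ∈ Finset.range (l + 1), T y i ω ≤ b (fun k => T x k ω))}
      = ∫⁻ c in E, ENNReal.ofReal (Real.exp (-((∑ y ∈ S, lam y) * (b c - a c))))
          ∂(P.map fun ω k => T x k ω) := by
  classical
  set f : Ω → ℕ → ℝ := fun ω k => T x k ω with hf
  set g : Ω → S → ℕ → ℝ := fun ω y k => T y k ω with hg
  have hfm : Measurable f := hT.measurable_clock x
  have hgm : Measurable g := measurable_pi_lambda _ fun y => hT.measurable_clock y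
  have hfg : IndepFun f g P := by
    have h := hT.iIndepFun_clock.indepFun_finset {x} S (by simpa using hxS) hT.measurable_clock
    have hx : Measurable fun d : ({x} : Finset X) → ℕ → ℝ => d ⟨x, Finset.mem_singleton_self x⟩ :=
      measurable_pi_apply _
    exact h.comp hx measurable_id
  have := Measure.isProbabilityMeasure_map (μ := P) hfm.aemeasurable
  have := Measure.isProbabilityMeasure_map (μ := P) hgm.aemeasurable
  set W : Set ((ℕ → ℝ) × (S → ℕ → ℝ)) := {z | z.1 ∈ E ∧ ∀ y, ∀ l,
    ¬ (a z.1 < ∑ i ∈ Finset.range (l + 1), z.2 y i ∧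
      ∑ i ∈ Finset.range (l + 1), z.2 y i ≤ b z.1)} with hW
  have hWm : MeasurableSet W := by
    have hWi : W = Prod.fst ⁻¹' E ∩ ⋂ y, ⋂ l, {z : (ℕ → ℝ) × (S → ℕ → ℝ) |
        a z.1 < ∑ i ∈ Finset.range (l + 1), z.2 y i ∧ ∑ i ∈ Finset.range (l + 1), z.2 y i ≤ b z.1}ᶜ := by
      ext z; simp [hW]
    rw [hWi]
    refine (measurable_fst hE).inter
      (MeasurableSet.iInter fun y => MeasurableSet.iInter fun l => MeasurableSet.compl ?_)
    have : Measurable fun z : (ℕ → ℝ) × (S → ℕ → ℝ) => ∑ i ∈ Finset.range (l + 1), z.2 y i :=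
      Finset.measurable_sum _ fun i _ => by fun_prop
    exact (measurableSet_lt (ham.comp measurable_fst) this).inter
      (measurableSet_le this (hbm.comp measurable_fst))
  have e : {ω | f ω ∈ E ∧ ∀ y ∈ S, ∀ l,
      ¬ (a (f ω) < ∑ i ∈ Finset.range (l + 1), T y i ω ∧
        ∑ i ∈ Finset.range (l + 1), T y i ω ≤ b (f ω))} = (fun ω => (f ω, g ω)) ⁻¹' W := by
    ext ω; simp [hW, hg]
  rw [e, ← Measure.map_apply (hfm.prodMk hgm) hWm,
    (indepFun_iff_map_prod_eq_prod_map_map hfm.aemeasurable hgm.aemeasurable).1 hfg,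
    Measure.prod_apply hWm, ← lintegral_indicator hE]
  refine lintegral_congr fun c => ?_
  by_cases hc : c ∈ E
  · rw [Set.indicator_of_mem hc,
      ← hT.measure_no_arrival_finset hlam S (ha c hc) (hab c hc),
      Measure.map_apply hgm (measurable_prodMk_left hWm)]
    congr 1
    ext ω; simp [hW, hg, hc]
  · rw [Set.indicator_of_notMem hc]
    simp [hW, hc]

variable [Fintype X]

lemma rate_eq_add_sum (lam : X → ℝ) {B : Set X} {x : X} (hx : x ∈ B) [DecidableEq X]
    [DecidablePred (· ∈ B)] :
    rate lam B = lam x + ∑ y ∈ (Finset.univ.filter (· ∈ B)).erase x, lam y := by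
  rw [rate_eq_sum, Finset.add_sum_erase _ _ (by simpa using hx)]

lemma measurable_sum_range (k : ℕ) : Measurable fun c : ℕ → ℝ => ∑ i ∈ Finset.range k, c i :=
  Finset.measurable_sum _ fun i _ => measurable_pi_apply i

/-- The expected time until the next request in `B` is at most `1 / lam(B)`. -/
lemma lintegral_forwardGap_le (hlam : ∀ x, 0 < lam x) (hT : IsPoissonArrival lam T P)
    {B : Set X} {x : X} (hx : x ∈ B) (k : ℕ) :
    ∫⁻ ω, ENNReal.ofReal (forwardGap (fun x k => T x k ω) B x k) ∂P
      ≤ ENNReal.ofReal (1 / rate lam B) := by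
  classical
  refine lintegral_le_of_tail_le (hT.measurable_forwardGap B x k)
    (fun ω => forwardGap_nonneg _ B x k) (rate_pos hlam hx) zero_le_one fun u hu => ?_
  set S := (Finset.univ.filter (· ∈ B)).erase x with hS
  set s : (ℕ → ℝ) → ℝ := fun c => ∑ i ∈ Finset.range (k + 1), c i with hs
  have hsm : Measurable s := measurable_sum_range _
  -- A gap above `u` means that the own clock waits more than `u` and no other clock of `B` rings in
  -- `(s, s + u]`. The condition `0 ≤ s c` holds almost surely; it is there because windows must
  -- start at a nonnegative time.
  set E : Set (ℕ → ℝ) := {c | u < c (k + 1) ∧ 0 ≤ s c} with hE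
  have hEm : MeasurableSet E := (measurableSet_lt measurable_const (measurable_pi_apply _)).inter
    (measurableSet_le measurable_const hsm)
  have h1 := hT.measure_clock_mem_and_no_arrival hlam (S := S) (Finset.notMem_erase x _) hEm
    (a := s) (b := fun c => s c + u) hsm (hsm.add_const u) (fun c hc => hc.2)
    (fun c _ => by linarith)
  have h2 : P.map (fun ω k => T x k ω) E ≤ ENNReal.ofReal (Real.exp (-(lam x * u))) := by
    rw [Measure.map_apply (hT.measurable_clock x) hEm,
      ← measure_lt_of_map_eq_exp (hT.measurable x (k + 1)) (hlam x) (hT.law x (k + 1)) hu.le]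
    exact measure_mono fun ω hω => hω.1
  simp only [add_sub_cancel_left, lintegral_const, Measure.restrict_apply_univ] at h1
  calc P {ω | u < forwardGap (fun x k => T x k ω) B x k}
      ≤ P {ω | (fun k => T x k ω) ∈ E ∧ ∀ y ∈ S, ∀ l,
        ¬ (s (fun k => T x k ω) < ∑ i ∈ Finset.range (l + 1), T y i ω ∧
        ∑ i ∈ Finset.range (l + 1), T y i ω ≤ s (fun k => T x k ω) + u)} := by
        refine measure_mono_ae ?_
        filter_upwards [hT.ae_pos hlam] with ω hω hgap
        refine ⟨⟨lt_of_lt_of_le hgap (forwardGap_le_wait (T := fun x k => T x k ω) hω hx k),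
          arrival_nonneg (T := fun x k => T x k ω) (fun x k => (hω x k).le) x k⟩, ?_⟩
        rintro y hy l ⟨hl1, hl2⟩
        have hyB : y ∈ B := by simpa using Finset.mem_of_mem_erase hy
        have := forwardGap_le (fun x k => T x k ω) x k hyB hl1
        have hgap' : u < forwardGap (fun x k => T x k ω) B x k := hgap
        simp only [arrival] at this
        simp only [hs] at hl2
        linarith
    _ = ENNReal.ofReal (Real.exp (-((∑ y ∈ S, lam y) * u))) * P.map (fun ω k => T x k ω) E := h1
    _ ≤ ENNReal.ofReal (Real.exp (-((∑ y ∈ S, lam y) * u)))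
        * ENNReal.ofReal (Real.exp (-(lam x * u))) := by gcongr
    _ = ENNReal.ofReal (1 * Real.exp (-(rate lam B * u))) := by
        rw [← ENNReal.ofReal_mul (Real.exp_pos _).le, ← Real.exp_add, rate_eq_add_sum lam hx,
          one_mul]
        congr 2; ring

/-- It suffices that both waits of the clock at `x` around request `k` exceed `u` and that the other
clocks of `B` are silent in a window of length at most `2 * u`. For `k = 0` requiring the first wait
to exceed `u` is more than necessary, but it still gives a lower bound. -/
lemma le_measure_le_nearGap (hlam : ∀ x, 0 < lam x) (hT : IsPoissonArrival lam T P)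
    {B : Set X} {x : X} (hx : x ∈ B) (k : ℕ) {q u : ℝ} (hu : 0 < u) (huq : u ≤ q) :
    ENNReal.ofReal (Real.exp (-(rate lam B * (2 * u))))
      ≤ P {ω | u ≤ nearGap (fun x k => T x k ω) B q x k} := by
  classical
  set S := (Finset.univ.filter (· ∈ B)).erase x with hS
  set s : (ℕ → ℝ) → ℝ := fun c => ∑ i ∈ Finset.range (k + 1), c i with hs
  have hsm : Measurable s := measurable_sum_range _
  set E : Set (ℕ → ℝ) := {c | (u < c k ∧ u < c (k + 1)) ∧ 0 ≤ s c} with hE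
  have hEm : MeasurableSet E := ((measurableSet_lt measurable_const (measurable_pi_apply _)).inter
    (measurableSet_lt measurable_const (measurable_pi_apply _))).inter
    (measurableSet_le measurable_const hsm)
  have h1 := hT.measure_clock_mem_and_no_arrival hlam (S := S) (Finset.notMem_erase x _) hEm
    -- Cutting the window at time `0` loses nothing, since arrivals are almost surely positive, and
    -- a shorter window is more likely to be empty.
    (a := fun c => max 0 (s c - u)) (b := fun c => s c + u) (by fun_prop) (hsm.add_const u)
    (fun c _ => le_max_left _ _) (fun c hc => max_le (by linarith [hc.2]) (by linarith))
  have h2 : P.map (fun ω k => T x k ω) E = ENNReal.ofReal (Real.exp (-(lam x * (2 * u)))) := by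
    have e : ENNReal.ofReal (Real.exp (-(lam x * (2 * u))))
        = P {ω | u < T x k ω} * P {ω | u < T x (k + 1) ω} := by
      rw [measure_lt_of_map_eq_exp (hT.measurable x k) (hlam x) (hT.law x k) hu.le,
        measure_lt_of_map_eq_exp (hT.measurable x (k + 1)) (hlam x) (hT.law x (k + 1)) hu.le,
        ← ENNReal.ofReal_mul (Real.exp_pos _).le, ← Real.exp_add]
      congr 2; ring
    rw [e, Measure.map_apply (hT.measurable_clock x) hEm]
    have hi := ((hT.iIndepFun_wait x).indepFun (Nat.succ_ne_self k).symm).measure_inter_preimage_eq_mul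
      (Set.Ioi u) (Set.Ioi u) measurableSet_Ioi measurableSet_Ioi
    refine Eq.trans (measure_congr ?_) hi
    filter_upwards [hT.ae_pos hlam] with ω hω
    refine propext ⟨fun h => h.1, fun h => ⟨h, ?_⟩⟩
    exact arrival_nonneg (T := fun x k => T x k ω) (fun x k => (hω x k).le) x k
  calc ENNReal.ofReal (Real.exp (-(rate lam B * (2 * u))))
      = ENNReal.ofReal (Real.exp (-((∑ y ∈ S, lam y) * (2 * u))))
        * P.map (fun ω k => T x k ω) E := by
        rw [h2, ← ENNReal.ofReal_mul (Real.exp_pos _).le, ← Real.exp_add, rate_eq_add_sum lam hx]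
        congr 2; ring
    _ = ∫⁻ c in E, ENNReal.ofReal (Real.exp (-((∑ y ∈ S, lam y) * (2 * u))))
          ∂(P.map fun ω k => T x k ω) := by simp
    _ ≤ ∫⁻ c in E, ENNReal.ofReal (Real.exp (-((∑ y ∈ S, lam y) *
          (s c + u - max 0 (s c - u))))) ∂(P.map fun ω k => T x k ω) := by
        refine lintegral_mono fun c => ENNReal.ofReal_le_ofReal (Real.exp_le_exp.2 ?_)
        have := Finset.sum_nonneg fun y (_ : y ∈ S) => (hlam y).le
        have h3 := le_max_right 0 (s c - u)
        exact neg_le_neg (mul_le_mul_of_nonneg_left (by linarith) this)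
    _ ≤ P {ω | u ≤ nearGap (fun x k => T x k ω) B q x k} := by
        rw [← h1]
        refine measure_mono_ae ?_
        filter_upwards [hT.ae_pos hlam] with ω hω
        rintro ⟨⟨⟨hk, hk1⟩, -⟩, hno⟩
        have hω0 : ∀ x k, 0 ≤ T x k ω := fun x k => (hω x k).le
        refine le_nearGap _ huq fun y hy l hne => ?_
        by_cases hyx : y = x
        · subst hyx
          have hlk : l ≠ k := fun h => hne (by rw [h])
          rcases lt_or_gt_of_ne hlk with h | h
          · have := arrival_le_sub (T := fun x k => T x k ω) hω0 y h
            rw [abs_sub_comm]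
            exact le_trans (by linarith) (le_abs_self _)
          · have := arrival_add_le (T := fun x k => T x k ω) hω0 y h
            exact le_trans (by linarith) (le_abs_self _)
        · have h3 := hno y (Finset.mem_erase.2 ⟨hyx, by simpa using hy⟩) l
          -- Positivity rules out the case created by the cut at `0`.
          have hA : 0 < ∑ i ∈ Finset.range (l + 1), T y i ω :=
            Finset.sum_pos (fun i _ => hω y i) (by simp)
          simp only [arrival]
          rw [not_and_or, not_lt, not_le, le_max_iff] at h3
          simp only [hs] at h3
          rw [le_abs]
          rcases h3 with (h3 | h3) | h3
          · linarith
          · right; linarith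
          · left; linarith

/-- The expected distance in time to the closest other request of an open ball of rate at most
`1 / q`, capped at `q`, is at least `q (1 - exp (-2)) / 2`. -/
lemma le_lintegral_nearGap (hlam : ∀ x, 0 < lam x) (hT : IsPoissonArrival lam T P)
    {B : Set X} {x : X} (hx : x ∈ B) (k : ℕ) {q : ℝ} (hq : 0 < q) (hB : rate lam B ≤ 1 / q) :
    ENNReal.ofReal (q * (1 - Real.exp (-2)) / 2)
      ≤ ∫⁻ ω, ENNReal.ofReal (nearGap (fun x k => T x k ω) B q x k) ∂P := by
  rw [lintegral_eq_lintegral_meas_le P (Eventually.of_forall fun ω =>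
    nearGap_nonneg _ B hq.le x k) (hT.measurable_nearGap B q x k).aemeasurable]
  -- The tail bound `exp (-2 * u / q)`, integrated up to the cap `q`, is the source of the factor `1
  -- - exp (-2)`.
  have hint : ∫ u in (0 : ℝ)..q, Real.exp (-2 / q * u) = q * (1 - Real.exp (-2)) / 2 := by
    rw [intervalIntegral.integral_comp_mul_left (fun u => Real.exp u)
      (div_ne_zero (by norm_num) hq.ne'), integral_exp]
    have : -2 / q * q = -2 := by field_simp
    rw [this, mul_zero, Real.exp_zero, smul_eq_mul, inv_div]
    ring
  rw [← hint, intervalIntegral.integral_of_le hq.le, ofReal_integral_eq_lintegral_ofReal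
    ((Continuous.integrableOn_Icc (by fun_prop)).mono_set Set.Ioc_subset_Icc_self)
    (Eventually.of_forall fun _ => (Real.exp_pos _).le)]
  refine (setLIntegral_mono' measurableSet_Ioc fun u hu => ?_).trans
    (lintegral_mono_set Set.Ioc_subset_Ioi_self)
  refine le_trans (ENNReal.ofReal_le_ofReal (Real.exp_le_exp.2 ?_))
    (hT.le_measure_le_nearGap hlam hx k hu.1 hu.2)
  have := mul_le_mul_of_nonneg_right hB (by linarith [hu.1] : 0 ≤ 2 * u)
  have h2 : 1 / q * (2 * u) = -(-2 / q * u) := by ring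
  linarith

end IsPoissonArrival

/-! ### Asymptotic frequencies of the locations -/

section CountingLaw

variable {X : Type*} [Fintype X] [Nonempty X] {T : X → ℕ → ℝ}

/-- Lower half of a renewal sandwich: the time of request `m` lies between the partial sums of the
waits at `x` with `arrived T m x` and with one more term. -/
lemma sum_range_arrived_le (hT : ∀ x k, 0 ≤ T x k) (m : ℕ) (x : X) :
    ∑ i ∈ Finset.range (arrived T m x), T x i ≤ reqTime T m := by
  rcases Nat.eq_zero_or_pos (arrived T m x) with h | h
  · rw [h, Finset.sum_range_zero]
    exact arrival_nonneg hT _ _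
  · obtain ⟨k, hk⟩ := Nat.exists_eq_succ_of_ne_zero h.ne'
    have := arrival_le_reqTime hT (m := m) (k := k) (x := x) (by omega)
    rwa [hk]

lemma le_sum_range_arrived_succ (m : ℕ) (x : X) :
    reqTime T m ≤ ∑ i ∈ Finset.range (arrived T m x + 1), T x i :=
  reqTime_le T m x

/-- By pigeonhole, among many requests some point has received many, and its clock has then run for
long. -/
lemma tendsto_reqTime (hT : ∀ x k, 0 ≤ T x k)
    (hlim : ∀ x, Tendsto (fun n => ∑ i ∈ Finset.range n, T x i) atTop atTop) :
    Tendsto (reqTime T) atTop atTop := by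
  refine tendsto_atTop.2 fun C => ?_
  have h1 : ∀ᶠ n : ℕ in atTop, ∀ x, C ≤ ∑ i ∈ Finset.range n, T x i :=
    eventually_all.2 fun x => (hlim x).eventually_ge_atTop C
  obtain ⟨B, hB⟩ := eventually_atTop.1 h1
  filter_upwards [eventually_gt_atTop (Fintype.card X * B)] with m hm
  obtain ⟨y, hy⟩ : ∃ y, B ≤ arrived T m y := by
    by_contra! h
    have h2 : ∑ x, arrived T m x ≤ ∑ _x : X, B := Finset.sum_le_sum fun x _ => (h x).le
    rw [sum_arrived] at h2
    simp at h2
    omega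
  exact (hB _ hy y).trans (sum_range_arrived_le hT m y)

lemma tendsto_arrived (hT : ∀ x k, 0 ≤ T x k)
    (hlim : ∀ x, Tendsto (fun n => ∑ i ∈ Finset.range n, T x i) atTop atTop) (x : X) :
    Tendsto (fun m => arrived T m x) atTop atTop := by
  refine tendsto_atTop.2 fun b => ?_
  filter_upwards [(tendsto_reqTime hT hlim).eventually_gt_atTop
    (∑ i ∈ Finset.range (b + 1), T x i)] with m hm
  by_contra! hlt
  have h1 := le_sum_range_arrived_succ (T := T) m x
  have h2 : ∑ i ∈ Finset.range (arrived T m x + 1), T x i ≤ ∑ i ∈ Finset.range (b + 1), T x i :=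
    Finset.sum_le_sum_of_subset_of_nonneg (Finset.range_mono (by omega)) fun i _ _ => hT x i
  linarith

/-- If the waiting times at each `x` average to `1 / lam x`, then the proportion of the requests
at `x` tends to `lam x / ∑ y, lam y`. -/
lemma tendsto_arrived_div (hT : ∀ x k, 0 ≤ T x k) {lam : X → ℝ} (hlam : ∀ x, 0 < lam x)
    (hlim : ∀ x, Tendsto (fun n : ℕ => (∑ i ∈ Finset.range n, T x i) / n) atTop
      (nhds (1 / lam x))) (x : X) :
    Tendsto (fun m : ℕ => (arrived T m x : ℝ) / m) atTop (nhds (lam x / ∑ y, lam y)) := by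
  have htop : ∀ x, Tendsto (fun n => ∑ i ∈ Finset.range n, T x i) atTop atTop := fun x =>
    tendsto_atTop_of_tendsto_div (one_div_pos.2 (hlam x)) (hlim x)
  have hN := tendsto_arrived hT htop
  have ht := tendsto_reqTime hT htop
  have h1 : ∀ y, Tendsto (fun m => (arrived T m y : ℝ) / reqTime T m) atTop (nhds (lam y)) := by
    intro y
    have hlow := (hlim y).comp (hN y)
    have hup : Tendsto (fun m => (∑ i ∈ Finset.range (arrived T m y + 1), T y i)
        / (arrived T m y : ℝ)) atTop (nhds (1 / lam y)) := by
      have e1 := (hlim y).comp ((tendsto_add_atTop_nat 1).comp (hN y))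
      have e2 : Tendsto (fun m => 1 + 1 / (arrived T m y : ℝ)) atTop (nhds (1 + 0)) :=
        tendsto_const_nhds.add (tendsto_one_div_atTop_nhds_zero_nat.comp (hN y))
      have e3 := e1.mul e2
      rw [add_zero, mul_one] at e3
      refine e3.congr' ?_
      filter_upwards [(hN y).eventually_gt_atTop 0] with m hm
      have : (arrived T m y : ℝ) ≠ 0 := by positivity
      simp only [Function.comp_apply, Nat.cast_add, Nat.cast_one]
      field_simp
    have hmid : Tendsto (fun m => reqTime T m / (arrived T m y : ℝ)) atTop
        (nhds (1 / lam y)) := by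
      refine tendsto_of_tendsto_of_tendsto_of_le_of_le hlow hup (fun m => ?_) fun m => ?_
      · exact div_le_div_of_nonneg_right (sum_range_arrived_le hT m y) (Nat.cast_nonneg _)
      · exact div_le_div_of_nonneg_right (le_sum_range_arrived_succ m y) (Nat.cast_nonneg _)
    have := hmid.inv₀ (one_div_pos.2 (hlam y)).ne'
    simpa using this
  -- Summing the counts per unit of time over all points gives the total rate; dividing by it
  -- eliminates the random time `reqTime T m`.
  have h2 : Tendsto (fun m : ℕ => (m : ℝ) / reqTime T m) atTop (nhds (∑ y, lam y)) := by
    have := tendsto_finsetSum (Finset.univ : Finset X) fun y _ => h1 y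
    refine this.congr fun m => ?_
    rw [← Finset.sum_div, ← Nat.cast_sum, sum_arrived]
  have hpos : 0 < ∑ y, lam y := Finset.sum_pos (fun y _ => hlam y) Finset.univ_nonempty
  refine ((h1 x).div h2 hpos.ne').congr' ?_
  filter_upwards [ht.eventually_gt_atTop 0] with m hm
  exact div_div_div_cancel_right₀ hm.ne' _ _

end CountingLaw

/-! ### Measurability of the counts -/

section Measurability

variable {X Ω : Type*} [Finite X] [Nonempty X] [MeasurableSpace Ω] {T : X → ℕ → Ω → ℝ}

lemma measurable_arrived (hT : ∀ x k, Measurable (T x k)) (m : ℕ) :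
    Measurable fun ω => arrived (fun x k => T x k ω) m := by
  classical
  let _ : MeasurableSpace X := ⊤
  induction m with
  | zero => exact measurable_const
  | succ m ih =>
    have harr : ∀ x k, Measurable fun ω => arrival (fun x k => T x k ω) x k := fun x k =>
      Finset.measurable_sum _ fun i _ => hT x i
    have hnow : ∀ x, Measurable fun ω =>
        arrival (fun x k => T x k ω) x (arrived (fun x k => T x k ω) m x) := by
      intro x
      have h : Measurable fun z : ℕ × Ω => arrival (fun x k => T x k z.2) x z.1 :=
        measurable_from_prod_countable_right fun k => harr x k
      exact h.comp (((measurable_pi_apply x).comp ih).prodMk measurable_id)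
    -- The choice made in `nextPoint` depends on `ω` only through the predicate of being a
    -- minimiser. It therefore factors through the finite space `X → Prop`, on which every function
    -- is measurable.
    let Φ : (X → Prop) → X := fun s => if h : ∃ x, s x then h.choose else Classical.arbitrary X
    have hnext : ∀ ω, nextPoint (fun x k => T x k ω) (arrived (fun x k => T x k ω) m)
        = Φ fun x => ∀ y, arrival (fun x k => T x k ω) x (arrived (fun x k => T x k ω) m x)
          ≤ arrival (fun x k => T x k ω) y (arrived (fun x k => T x k ω) m y) := by
      intro ω
      exact (dif_pos (Finite.exists_min fun x => arrival (fun x k => T x k ω) x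
        (arrived (fun x k => T x k ω) m x))).symm
    have hnextm : Measurable fun ω =>
        nextPoint (fun x k => T x k ω) (arrived (fun x k => T x k ω) m) := by
      simp_rw [hnext]
      refine (Measurable.of_discrete (f := Φ)).comp (measurable_pi_lambda _ fun x => ?_)
      refine measurableSet_setOfPred.1 ?_
      rw [Set.ofPred_forall]
      exact MeasurableSet.iInter fun y => measurableSet_le (hnow x) (hnow y)
    exact (Measurable.of_discrete (f := fun z : (X → ℕ) × X =>
      Function.update z.1 z.2 (z.1 z.2 + 1))).comp (ih.prodMk hnextm)

lemma measurable_arrived_apply (hT : ∀ x k, Measurable (T x k)) (m : ℕ) (x : X) :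
    Measurable fun ω => arrived (fun x k => T x k ω) m x :=
  (measurable_pi_apply x).comp (measurable_arrived hT m)

end Measurability

/-! ### Expected sums with a random number of terms -/

section RandomSums

variable {Ω : Type*} [MeasurableSpace Ω] {P : Measure Ω}

lemma measurable_sum_range_random {Z : ℕ → Ω → ℝ} (hZ : ∀ k, Measurable (Z k)) {N : Ω → ℕ}
    (hN : Measurable N) : Measurable fun ω => ∑ k ∈ Finset.range (N ω), Z k ω := by
  have h : Measurable fun z : ℕ × Ω => ∑ k ∈ Finset.range z.1, Z k z.2 :=
    measurable_from_prod_countable_right fun n =>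
      Finset.measurable_sum (Finset.range n) fun i _ => hZ i
  exact h.comp (hN.prodMk measurable_id)

lemma lintegral_ofReal_sum {ι : Type*} {Z : ι → Ω → ℝ} (s : Finset ι)
    (hZ : ∀ k ∈ s, Measurable (Z k)) (hZ0 : ∀ k ω, 0 ≤ Z k ω) :
    ∫⁻ ω, ENNReal.ofReal (∑ k ∈ s, Z k ω) ∂P = ∑ k ∈ s, ∫⁻ ω, ENNReal.ofReal (Z k ω) ∂P := by
  rw [← lintegral_finsetSum s fun k hk => (hZ k hk).ennreal_ofReal]
  exact lintegral_congr fun ω => ENNReal.ofReal_sum_of_nonneg fun k _ => hZ0 k ω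

variable [IsProbabilityMeasure P]

/-- The ratios `N m / m` stay in `[0, 1]`, so dominated convergence upgrades almost sure convergence
to convergence in mean. -/
lemma eventually_lintegral_abs_sub_le {N : ℕ → Ω → ℕ} (hN : ∀ m, Measurable (N m))
    (hNm : ∀ m ω, N m ω ≤ m) {r : ℝ} (hr0 : 0 ≤ r) (hr1 : r ≤ 1)
    (hlim : ∀ᵐ ω ∂P, Tendsto (fun m : ℕ => (N m ω : ℝ) / m) atTop (nhds r)) {η : ℝ}
    (hη : 0 < η) :
    ∀ᶠ m : ℕ in atTop, ∫⁻ ω, ENNReal.ofReal |(N m ω : ℝ) - m * r| ∂P ≤ ENNReal.ofReal (m * η) := by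
  have hNr : ∀ m, Measurable fun ω => (N m ω : ℝ) := fun m => measurable_from_nat.comp (hN m)
  have h := tendsto_lintegral_of_dominated_convergence (μ := P)
    (F := fun m ω => ENNReal.ofReal |(N m ω : ℝ) / m - r|) (f := fun _ => 0) (fun _ => 1)
    (fun m => (((hNr m).div_const _).sub_const r).abs.ennreal_ofReal)
    (fun m => Eventually.of_forall fun ω => by
      have h1 : (N m ω : ℝ) / m ≤ 1 :=
        div_le_one_of_le₀ (by exact_mod_cast hNm m ω) (Nat.cast_nonneg _)
      have h2 : 0 ≤ (N m ω : ℝ) / m := by positivity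
      rw [← ENNReal.ofReal_one]
      exact ENNReal.ofReal_le_ofReal (abs_le.2 ⟨by linarith, by linarith⟩))
    (by simp)
    (by
      filter_upwards [hlim] with ω hω
      have h3 := (hω.sub_const r).abs
      rw [sub_self, abs_zero] at h3
      have := (ENNReal.continuous_ofReal.tendsto 0).comp h3
      rwa [ENNReal.ofReal_zero] at this)
  rw [lintegral_zero, ENNReal.tendsto_nhds_zero] at h
  filter_upwards [h (ENNReal.ofReal η) (by simpa using hη), eventually_gt_atTop 0] with m hm hm0
  have hmpos : (0 : ℝ) < m := by exact_mod_cast hm0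
  calc ∫⁻ ω, ENNReal.ofReal |(N m ω : ℝ) - m * r| ∂P
      = ∫⁻ ω, ENNReal.ofReal m * ENNReal.ofReal |(N m ω : ℝ) / m - r| ∂P := by
        refine lintegral_congr fun ω => ?_
        rw [← ENNReal.ofReal_mul hmpos.le]
        congr 1
        rw [← abs_of_pos hmpos, ← abs_mul, abs_of_pos hmpos]
        congr 1
        field_simp
    _ = ENNReal.ofReal m * ∫⁻ ω, ENNReal.ofReal |(N m ω : ℝ) / m - r| ∂P :=
        lintegral_const_mul _ (((hNr m).div_const _).sub_const r).abs.ennreal_ofReal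
    _ ≤ ENNReal.ofReal m * ENNReal.ofReal η := by gcongr
    _ = ENNReal.ofReal (m * η) := (ENNReal.ofReal_mul hmpos.le).symm

/-- Upper bound for the expectation of a sum with a random number of uniformly integrable terms,
when that number is close to `m r`. -/
lemma eventually_lintegral_sum_le {N : ℕ → Ω → ℕ} (hN : ∀ m, Measurable (N m))
    (hNm : ∀ m ω, N m ω ≤ m) {r : ℝ} (hr0 : 0 ≤ r) (hr1 : r ≤ 1)
    (hlim : ∀ᵐ ω ∂P, Tendsto (fun m : ℕ => (N m ω : ℝ) / m) atTop (nhds r))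
    {Z : ℕ → Ω → ℝ} (hZ : ∀ k, Measurable (Z k)) (hZ0 : ∀ k ω, 0 ≤ Z k ω) {c : ℝ} (hc : 0 ≤ c)
    (hmean : ∀ k, ∫⁻ ω, ENNReal.ofReal (Z k ω) ∂P ≤ ENNReal.ofReal c)
    (htail : ∀ ε > 0, ∃ L : ℝ, 0 ≤ L ∧ ∀ k,
      ∫⁻ ω, ENNReal.ofReal (Z k ω - L) ∂P ≤ ENNReal.ofReal ε) {ε : ℝ} (hε : 0 < ε) :
    ∀ᶠ m : ℕ in atTop, ∫⁻ ω, ENNReal.ofReal (∑ k ∈ Finset.range (N m ω), Z k ω) ∂P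
      ≤ ENNReal.ofReal (m * (c * r + ε)) := by
  obtain ⟨L, hL0, hL⟩ := htail (ε / 3) (by positivity)
  -- The error is spent in thirds: the excess over the level `L`, the deviation of `N m` times `L`,
  -- and the rounding of `m * r`. The denominator `L + 1` covers `L = 0`.
  have hη : 0 < ε / 3 / (L + 1) := by positivity
  have hbig : ∀ᶠ m : ℕ in atTop, c ≤ m * (ε / 3) :=
    (tendsto_natCast_atTop_atTop.atTop_mul_const (by positivity)).eventually_ge_atTop c
  filter_upwards [eventually_lintegral_abs_sub_le hN hNm hr0 hr1 hlim hη, hbig] with m hm hcm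
  set K := ⌈(m : ℝ) * r⌉₊ with hK
  have hKr : (m : ℝ) * r ≤ K := Nat.le_ceil _
  have hKr' : (K : ℝ) ≤ m * r + 1 := (Nat.ceil_lt_add_one (by positivity)).le
  have hNr : Measurable fun ω => (N m ω : ℝ) := measurable_from_nat.comp (hN m)
  -- Each term beyond the deterministic index `K` is at most `L` plus its excess over `L`. The
  -- excesses are summed over all indices below `m`, so no independence between `N m` and the terms
  -- is used.
  have hpt : ∀ ω, ENNReal.ofReal (∑ k ∈ Finset.range (N m ω), Z k ω)
      ≤ (ENNReal.ofReal (∑ k ∈ Finset.range K, Z k ω)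
        + ∑ k ∈ Finset.range m, ENNReal.ofReal (Z k ω - L))
        + ENNReal.ofReal L * ENNReal.ofReal |(N m ω : ℝ) - m * r| := by
    intro ω
    have e1 : ∑ k ∈ Finset.range m, ENNReal.ofReal (Z k ω - L)
        = ENNReal.ofReal (∑ k ∈ Finset.range m, max (Z k ω - L) 0) := by
      rw [ENNReal.ofReal_sum_of_nonneg fun k _ => le_max_right _ _]
      exact Finset.sum_congr rfl fun k _ => by
        rw [ENNReal.ofReal_max, ENNReal.ofReal_zero, max_eq_left (zero_le)]
    have hs1 : 0 ≤ ∑ k ∈ Finset.range K, Z k ω := Finset.sum_nonneg fun k _ => hZ0 k ω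
    have hs2 : 0 ≤ ∑ k ∈ Finset.range m, max (Z k ω - L) 0 :=
      Finset.sum_nonneg fun k _ => le_max_right _ _
    rw [e1, ← ENNReal.ofReal_mul hL0, ← ENNReal.ofReal_add hs1 hs2,
      ← ENNReal.ofReal_add (add_nonneg hs1 hs2) (by positivity)]
    refine ENNReal.ofReal_le_ofReal ?_
    rcases le_total (N m ω) K with h | h
    · have : ∑ k ∈ Finset.range (N m ω), Z k ω ≤ ∑ k ∈ Finset.range K, Z k ω :=
        Finset.sum_le_sum_of_subset_of_nonneg (Finset.range_mono h) fun k _ _ => hZ0 k ω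
      have : 0 ≤ L * |(N m ω : ℝ) - m * r| := by positivity
      linarith
    · rw [← Finset.sum_range_add_sum_Ico _ h]
      have h1 : ∑ k ∈ Finset.Ico K (N m ω), Z k ω
          ≤ ∑ k ∈ Finset.Ico K (N m ω), (max (Z k ω - L) 0 + L) :=
        Finset.sum_le_sum fun k _ => by linarith [le_max_left (Z k ω - L) 0]
      have h2 : ∑ k ∈ Finset.Ico K (N m ω), max (Z k ω - L) 0
          ≤ ∑ k ∈ Finset.range m, max (Z k ω - L) 0 := by
        refine Finset.sum_le_sum_of_subset_of_nonneg (fun k hk => ?_) fun k _ _ => le_max_right _ _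
        exact Finset.mem_range.2 ((Finset.mem_Ico.1 hk).2.trans_le (hNm m ω))
      rw [Finset.sum_add_distrib, Finset.sum_const, Nat.card_Ico, nsmul_eq_mul,
        Nat.cast_sub h] at h1
      have h3 : ((N m ω : ℝ) - K) * L ≤ L * |(N m ω : ℝ) - m * r| := by
        rw [mul_comm]
        exact mul_le_mul_of_nonneg_left (le_trans (by linarith) (le_abs_self _)) hL0
      linarith
  calc ∫⁻ ω, ENNReal.ofReal (∑ k ∈ Finset.range (N m ω), Z k ω) ∂P
      ≤ (∑ k ∈ Finset.range K, ∫⁻ ω, ENNReal.ofReal (Z k ω) ∂P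
        + ∑ k ∈ Finset.range m, ∫⁻ ω, ENNReal.ofReal (Z k ω - L) ∂P)
        + ENNReal.ofReal L * ∫⁻ ω, ENNReal.ofReal |(N m ω : ℝ) - m * r| ∂P := by
        refine (lintegral_mono hpt).trans (le_of_eq ?_)
        rw [lintegral_add_right _ ((hNr.sub_const _).abs.ennreal_ofReal.const_mul _),
          lintegral_add_left (Finset.measurable_sum _ fun k _ => hZ k).ennreal_ofReal,
          lintegral_ofReal_sum _ (fun k _ => hZ k) hZ0,
          lintegral_finsetSum _ fun k _ => ((hZ k).sub_const L).ennreal_ofReal,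
          lintegral_const_mul _ (hNr.sub_const _).abs.ennreal_ofReal]
    _ ≤ (∑ k ∈ Finset.range K, ENNReal.ofReal c + ∑ k ∈ Finset.range m, ENNReal.ofReal (ε / 3))
        + ENNReal.ofReal L * ENNReal.ofReal (m * (ε / 3 / (L + 1))) := by
        gcongr with k _ k _
        · exact hmean k
        · exact hL k
    _ = ENNReal.ofReal (K * c + m * (ε / 3) + L * (m * (ε / 3 / (L + 1)))) := by
        have e : ∀ (n : ℕ) (y : ℝ), ENNReal.ofReal (n * y) = n * ENNReal.ofReal y := fun n y => by
          rw [ENNReal.ofReal_mul (Nat.cast_nonneg _), ENNReal.ofReal_natCast]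
        simp only [Finset.sum_const, Finset.card_range, nsmul_eq_mul]
        rw [ENNReal.ofReal_add (by positivity) (by positivity),
          ENNReal.ofReal_add (by positivity) (by positivity), ENNReal.ofReal_mul hL0, e, e, e]
    _ ≤ ENNReal.ofReal (m * (c * r + ε)) := by
        refine ENNReal.ofReal_le_ofReal ?_
        have h1 : (K : ℝ) * c ≤ (m * r + 1) * c := mul_le_mul_of_nonneg_right hKr' hc
        have h2 : L * (m * (ε / 3 / (L + 1))) ≤ m * (ε / 3) := by
          have : L * (m * (ε / 3 / (L + 1))) = m * (ε / 3) * (L / (L + 1)) := by field_simp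
          rw [this]
          exact mul_le_of_le_one_right (by positivity)
            (div_le_one_of_le₀ (by linarith) (by linarith))
        nlinarith

/-- Lower bound for the expectation of a sum with a random number of bounded terms, when that
number is close to `m r`. -/
lemma eventually_le_lintegral_sum {N : ℕ → Ω → ℕ} (hN : ∀ m, Measurable (N m))
    (hNm : ∀ m ω, N m ω ≤ m) {r : ℝ} (hr0 : 0 ≤ r) (hr1 : r ≤ 1)
    (hlim : ∀ᵐ ω ∂P, Tendsto (fun m : ℕ => (N m ω : ℝ) / m) atTop (nhds r))
    {Z : ℕ → Ω → ℝ} (hZ : ∀ k, Measurable (Z k)) (hZ0 : ∀ k ω, 0 ≤ Z k ω) {q : ℝ} (hq : 0 ≤ q)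
    (hZq : ∀ k ω, Z k ω ≤ q) {c : ℝ} (hc : 0 ≤ c)
    (hmean : ∀ k, ENNReal.ofReal c ≤ ∫⁻ ω, ENNReal.ofReal (Z k ω) ∂P) {ε : ℝ} (hε : 0 < ε) :
    ∀ᶠ m : ℕ in atTop, ENNReal.ofReal (m * (c * r - ε))
      ≤ ∫⁻ ω, ENNReal.ofReal (∑ k ∈ Finset.range (N m ω), Z k ω) ∂P := by
  have hη : 0 < ε / 2 / (q + 1) := by positivity
  have hbig : ∀ᶠ m : ℕ in atTop, c ≤ m * (ε / 2) :=
    (tendsto_natCast_atTop_atTop.atTop_mul_const (by positivity)).eventually_ge_atTop c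
  filter_upwards [eventually_lintegral_abs_sub_le hN hNm hr0 hr1 hlim hη, hbig] with m hm hcm
  set K := ⌊(m : ℝ) * r⌋₊ with hK
  have hKr : (K : ℝ) ≤ m * r := Nat.floor_le (by positivity)
  have hKr' : (m : ℝ) * r ≤ K + 1 := (Nat.lt_floor_add_one _).le
  have hNr : Measurable fun ω => (N m ω : ℝ) := measurable_from_nat.comp (hN m)
  -- If `N m` falls short of `K`, at most `|N m - m * r|` terms are missing, each at most `q`; here
  -- boundedness replaces truncation.
  have hpt : ∀ ω, ENNReal.ofReal (∑ k ∈ Finset.range K, Z k ω)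
      ≤ ENNReal.ofReal (∑ k ∈ Finset.range (N m ω), Z k ω)
        + ENNReal.ofReal q * ENNReal.ofReal |(N m ω : ℝ) - m * r| := by
    intro ω
    have hs1 : 0 ≤ ∑ k ∈ Finset.range (N m ω), Z k ω := Finset.sum_nonneg fun k _ => hZ0 k ω
    rw [← ENNReal.ofReal_mul hq, ← ENNReal.ofReal_add hs1 (by positivity)]
    refine ENNReal.ofReal_le_ofReal ?_
    rcases le_total K (N m ω) with h | h
    · have : ∑ k ∈ Finset.range K, Z k ω ≤ ∑ k ∈ Finset.range (N m ω), Z k ω :=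
        Finset.sum_le_sum_of_subset_of_nonneg (Finset.range_mono h) fun k _ _ => hZ0 k ω
      have : 0 ≤ q * |(N m ω : ℝ) - m * r| := by positivity
      linarith
    · rw [← Finset.sum_range_add_sum_Ico _ h]
      have h1 : ∑ k ∈ Finset.Ico (N m ω) K, Z k ω ≤ ∑ k ∈ Finset.Ico (N m ω) K, q :=
        Finset.sum_le_sum fun k _ => hZq k ω
      rw [Finset.sum_const, Nat.card_Ico, nsmul_eq_mul, Nat.cast_sub h] at h1
      have h3 : ((K : ℝ) - N m ω) * q ≤ q * |(N m ω : ℝ) - m * r| := by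
        rw [mul_comm]
        exact mul_le_mul_of_nonneg_left (le_trans (by linarith) (neg_le_abs _)) hq
      linarith
  have hmain : ENNReal.ofReal (K * c)
      ≤ ∫⁻ ω, ENNReal.ofReal (∑ k ∈ Finset.range (N m ω), Z k ω) ∂P
        + ENNReal.ofReal (q * (m * (ε / 2 / (q + 1)))) := by
    calc ENNReal.ofReal (K * c) = ∑ k ∈ Finset.range K, ENNReal.ofReal c := by
          rw [Finset.sum_const, Finset.card_range, nsmul_eq_mul,
            ENNReal.ofReal_mul (Nat.cast_nonneg _), ENNReal.ofReal_natCast]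
      _ ≤ ∑ k ∈ Finset.range K, ∫⁻ ω, ENNReal.ofReal (Z k ω) ∂P :=
          Finset.sum_le_sum fun k _ => hmean k
      _ = ∫⁻ ω, ENNReal.ofReal (∑ k ∈ Finset.range K, Z k ω) ∂P :=
          (lintegral_ofReal_sum _ (fun k _ => hZ k) hZ0).symm
      _ ≤ ∫⁻ ω, ENNReal.ofReal (∑ k ∈ Finset.range (N m ω), Z k ω) ∂P
          + ENNReal.ofReal q * ∫⁻ ω, ENNReal.ofReal |(N m ω : ℝ) - m * r| ∂P := by
          refine (lintegral_mono hpt).trans (le_of_eq ?_)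
          rw [lintegral_add_right _ ((hNr.sub_const _).abs.ennreal_ofReal.const_mul _),
            lintegral_const_mul _ (hNr.sub_const _).abs.ennreal_ofReal]
      _ ≤ _ := by
          rw [ENNReal.ofReal_mul hq]
          gcongr
  calc ENNReal.ofReal (m * (c * r - ε))
      ≤ ENNReal.ofReal (K * c - q * (m * (ε / 2 / (q + 1)))) := by
        refine ENNReal.ofReal_le_ofReal ?_
        have h1 : (m * r - 1) * c ≤ (K : ℝ) * c := mul_le_mul_of_nonneg_right (by linarith) hc
        have h2 : q * (m * (ε / 2 / (q + 1))) ≤ m * (ε / 2) := by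
          have : q * (m * (ε / 2 / (q + 1))) = m * (ε / 2) * (q / (q + 1)) := by field_simp
          rw [this]
          exact mul_le_of_le_one_right (by positivity)
            (div_le_one_of_le₀ (by linarith) (by linarith))
        nlinarith
    _ = ENNReal.ofReal (K * c) - ENNReal.ofReal (q * (m * (ε / 2 / (q + 1)))) :=
        ENNReal.ofReal_sub _ (by positivity)
    _ ≤ _ := tsub_le_iff_right.2 hmain

end RandomSums

lemma limsup_div_le {A B : ℕ → ENNReal} {a b : ℝ} (hb : 0 < b)
    (hA : ∀ ε > 0, ∀ᶠ m : ℕ in atTop, A m ≤ ENNReal.ofReal (m * (a + ε)))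
    (hB : ∀ ε > 0, ∀ᶠ m : ℕ in atTop, ENNReal.ofReal (m * (b - ε)) ≤ B m) :
    limsup (fun m => A m / B m) atTop ≤ ENNReal.ofReal (a / b) := by
  have hlim : Tendsto (fun ε : ℝ => ENNReal.ofReal ((a + ε) / (b - ε)))
      (nhdsWithin 0 (Set.Ioi 0)) (nhds (ENNReal.ofReal (a / b))) := by
    refine tendsto_nhdsWithin_of_tendsto_nhds
      ((ENNReal.continuous_ofReal.tendsto _).comp ?_)
    have h1 : Tendsto (fun ε : ℝ => a + ε) (nhds 0) (nhds (a + 0)) :=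
      tendsto_const_nhds.add tendsto_id
    have h2 : Tendsto (fun ε : ℝ => b - ε) (nhds 0) (nhds (b - 0)) :=
      tendsto_const_nhds.sub tendsto_id
    rw [add_zero] at h1
    rw [sub_zero] at h2
    exact h1.div h2 hb.ne'
  refine ge_of_tendsto hlim ?_
  filter_upwards [Ioo_mem_nhdsGT hb] with ε hε
  refine limsup_le_of_le (by isBoundedDefault) ?_
  filter_upwards [hA ε hε.1, hB ε hε.1, eventually_gt_atTop 0] with m hAm hBm hm
  have hm' : (0 : ℝ) < m := by exact_mod_cast hm
  have hbε : 0 < b - ε := sub_pos.2 hε.2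
  calc A m / B m ≤ ENNReal.ofReal (m * (a + ε)) / ENNReal.ofReal (m * (b - ε)) :=
        ENNReal.div_le_div hAm hBm
    _ = ENNReal.ofReal ((a + ε) / (b - ε)) := by
        rw [← ENNReal.ofReal_div_of_pos (by positivity), mul_div_mul_left _ _ hm'.ne']

/-! ### Expected costs and the ratio -/

section Expectations

variable {X Ω : Type*} [MeasurableSpace Ω] {P : Measure Ω}

/-- The level `L` depends only on the exponential parameter, so one level serves all the waiting
times of a clock. -/
lemma exists_lintegral_sub_le {r : ℝ} (hr : 0 < r) {ε : ℝ} (hε : 0 < ε) :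
    ∃ L : ℝ, 0 ≤ L ∧ ∀ V : Ω → ℝ, Measurable V → P.map V = expMeasure r →
      ∫⁻ ω, ENNReal.ofReal (V ω - L) ∂P ≤ ENNReal.ofReal ε := by
  have hlim : Tendsto (fun L : ℝ => Real.exp (-(r * L)) / r) atTop (nhds (0 / r)) := by
    refine Tendsto.div_const ?_ r
    exact Real.tendsto_exp_neg_atTop_nhds_zero.comp (tendsto_id.const_mul_atTop hr)
  rw [zero_div] at hlim
  obtain ⟨L, hLε, hL0⟩ := ((hlim.eventually_lt_const hε).and (eventually_ge_atTop 0)).exists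
  refine ⟨L, hL0, fun V hV hlaw => ?_⟩
  have h := lintegral_le_of_tail_le (P := P) (f := fun ω => max (V ω - L) 0)
    ((hV.sub_const L).max measurable_const) (fun ω => le_max_right _ _) hr
    (Real.exp_pos (-(r * L))).le fun u hu => by
      rw [← Real.exp_add, show -(r * L) + -(r * u) = -(r * (L + u)) by ring,
        ← measure_lt_of_map_eq_exp hV hr hlaw (by linarith)]
      refine measure_mono fun ω hω => ?_
      rcases lt_max_iff.1 (show u < max (V ω - L) 0 from hω) with h | h
      · exact show L + u < V ω by linarith
      · exact absurd h hu.not_gt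
  exact (lintegral_mono fun ω => ENNReal.ofReal_le_ofReal (le_max_left _ _)).trans
    (h.trans (ENNReal.ofReal_le_ofReal hLε.le))

variable [Fintype X] {lam : X → ℝ} {T : X → ℕ → Ω → ℝ}

lemma div_sum_nonneg (hlam : ∀ x, 0 < lam x) (x : X) : 0 ≤ lam x / ∑ y, lam y :=
  div_nonneg (hlam x).le (Finset.sum_nonneg fun y _ => (hlam y).le)

lemma div_sum_le_one (hlam : ∀ x, 0 < lam x) (x : X) : lam x / ∑ y, lam y ≤ 1 :=
  div_le_one_of_le₀ (Finset.single_le_sum (f := lam) (fun y _ => (hlam y).le) (Finset.mem_univ x))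
    (Finset.sum_nonneg fun y _ => (hlam y).le)

variable [Nonempty X]

lemma IsPoissonArrival.ae_tendsto_arrived_div (hlam : ∀ x, 0 < lam x)
    (hT : IsPoissonArrival lam T P) (x : X) :
    ∀ᵐ ω ∂P, Tendsto (fun m : ℕ => (arrived (fun x k => T x k ω) m x : ℝ) / m) atTop
      (nhds (lam x / ∑ y, lam y)) := by
  filter_upwards [hT.ae_pos hlam, ae_all_iff.2 fun y => ae_tendsto_sum_div (hT.measurable y)
    (hlam y) (hT.law y) (hT.iIndepFun_wait y)] with ω hω hlim
  exact tendsto_arrived_div (T := fun x k => T x k ω) (fun x k => (hω x k).le) hlam hlim x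

variable [IsProbabilityMeasure P] [PseudoMetricSpace X] {p : ℝ}

/-- The expected cost of the algorithm is at most
`m (2 ∑ x, (lam x / lam(X)) min (p, ρ x) + o(1))`. -/
lemma eventually_lintegral_cost_le (hlam : ∀ x, 0 < lam x) (hp : 0 < p)
    (hT : IsPoissonArrival lam T P) {ALG : ∀ m : ℕ, Ω → Solution m}
    (hALG : ∀ m, ∀ᵐ ω ∂P, IsOutput p lam (requests (fun x k => T x k ω) m) (ALG m ω))
    {ε : ℝ} (hε : 0 < ε) :
    ∀ᶠ m : ℕ in atTop,
      ∫⁻ ω, ENNReal.ofReal (cost p (requests (fun x k => T x k ω) m) (ALG m ω)) ∂P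
        ≤ ENNReal.ofReal (m * (2 * ∑ x, min p (radius lam x) * (lam x / ∑ y, lam y) + ε)) := by
  set q : X → ℝ := fun x => min p (radius lam x) with hq
  have hq0 : ∀ x, 0 ≤ q x := fun x => le_min hp.le (radius_nonneg lam x)
  set r : X → ℝ := fun x => lam x / ∑ y, lam y with hr
  have hr0 : ∀ x, 0 ≤ r x := div_sum_nonneg hlam
  set Z : X → ℕ → Ω → ℝ := fun x k ω => (if radius lam x < p then
    forwardGap (fun x k => T x k ω) (Metric.closedBall x (radius lam x)) x k else 0) + q x with hZ
  set N : ℕ → Ω → X → ℕ := fun m ω => arrived (fun x k => T x k ω) m with hN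
  have hball : ∀ x, x ∈ Metric.closedBall x (radius lam x) := fun x =>
    Metric.mem_closedBall_self (radius_nonneg lam x)
  have hZm : ∀ x k, Measurable (Z x k) := fun x k => by
    simp only [hZ]
    split_ifs
    · exact (hT.measurable_forwardGap _ x k).add_const _
    · exact measurable_const
  have hZ0 : ∀ x k ω, 0 ≤ Z x k ω := fun x k ω => by
    refine add_nonneg ?_ (hq0 x)
    split_ifs
    · exact forwardGap_nonneg _ _ x k
    · exact le_rfl
  have hmean : ∀ x k, ∫⁻ ω, ENNReal.ofReal (Z x k ω) ∂P ≤ ENNReal.ofReal (2 * q x) := by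
    intro x k
    simp only [hZ]
    split_ifs with h
    · have e : ∀ ω, ENNReal.ofReal (forwardGap (fun x k => T x k ω)
          (Metric.closedBall x (radius lam x)) x k + q x)
          = ENNReal.ofReal (forwardGap (fun x k => T x k ω)
            (Metric.closedBall x (radius lam x)) x k) + ENNReal.ofReal (q x) := fun ω =>
        ENNReal.ofReal_add (forwardGap_nonneg _ _ x k) (hq0 x)
      simp_rw [e]
      rw [lintegral_add_right _ measurable_const, lintegral_const, measure_univ, mul_one, two_mul,
        ENNReal.ofReal_add (hq0 x) (hq0 x)]
      gcongr
      refine (hT.lintegral_forwardGap_le hlam (hball x) k).trans (ENNReal.ofReal_le_ofReal ?_)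
      simp only [hq, min_eq_right h.le]
      exact one_div_rate_closedBall_radius_le hlam x
    · simp only [zero_add, lintegral_const, measure_univ, mul_one]
      exact ENNReal.ofReal_le_ofReal (by linarith [hq0 x])
  have htail : ∀ x, ∀ ε > 0, ∃ L : ℝ, 0 ≤ L ∧ ∀ k,
      ∫⁻ ω, ENNReal.ofReal (Z x k ω - L) ∂P ≤ ENNReal.ofReal ε := by
    intro x ε hε
    obtain ⟨L, hL0, hL⟩ := exists_lintegral_sub_le (P := P) (hlam x) hε
    refine ⟨L + q x, by linarith [hq0 x], fun k => ?_⟩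
    refine (lintegral_mono_ae ?_).trans (hL _ (hT.measurable x (k + 1)) (hT.law x (k + 1)))
    filter_upwards [hT.ae_pos hlam] with ω hω
    refine ENNReal.ofReal_le_ofReal ?_
    simp only [hZ]
    split_ifs
    · have := forwardGap_le_wait (T := fun x k => T x k ω) hω (hball x) k
      linarith
    · linarith [hω x (k + 1)]
  -- One share of the error for each point and one for the bounded cost of the final phase.
  set δ : ℝ := ε / (Fintype.card X + 1) with hδ
  have hδ0 : 0 < δ := by positivity
  have hsum : ∀ᶠ m : ℕ in atTop, ∀ x,
      ∫⁻ ω, ENNReal.ofReal (∑ k ∈ Finset.range (N m ω x), Z x k ω) ∂P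
        ≤ ENNReal.ofReal (m * (2 * q x * r x + δ)) :=
    eventually_all.2 fun x => eventually_lintegral_sum_le
      (N := fun m ω => N m ω x) (fun m => measurable_arrived_apply hT.measurable m x)
      (fun m ω => arrived_le _ m x) (hr0 x) (div_sum_le_one hlam x)
      (hT.ae_tendsto_arrived_div hlam x) (hZm x) (hZ0 x)
      (by linarith [hq0 x]) (hmean x) (htail x) hδ0
  have hM : ∀ x y : X, dist x y ≤ Metric.diam (Set.univ : Set X) := fun x y =>
    Metric.dist_le_diam_of_mem Set.finite_univ.isBounded (Set.mem_univ x) (Set.mem_univ y)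
  set C : ℝ := Fintype.card X * (Metric.diam (Set.univ : Set X) + p) with hC
  have hC0 : 0 ≤ C := mul_nonneg (Nat.cast_nonneg _) (add_nonneg Metric.diam_nonneg hp.le)
  have hbig : ∀ᶠ m : ℕ in atTop, C ≤ m * δ :=
    (tendsto_natCast_atTop_atTop.atTop_mul_const hδ0).eventually_ge_atTop C
  filter_upwards [hsum, hbig] with m hm hCm
  have hpos : ∀ x, 0 ≤ (m : ℝ) * (2 * q x * r x + δ) := fun x => by
    have := hq0 x
    have := hr0 x
    positivity
  calc ∫⁻ ω, ENNReal.ofReal (cost p (requests (fun x k => T x k ω) m) (ALG m ω)) ∂P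
      ≤ ∫⁻ ω, (ENNReal.ofReal (∑ x, ∑ k ∈ Finset.range (N m ω x), Z x k ω)
          + ENNReal.ofReal C) ∂P := by
        refine lintegral_mono_ae ?_
        filter_upwards [hT.ae_pos hlam, hALG m] with ω hω hout
        rw [← ENNReal.ofReal_add (Finset.sum_nonneg fun x _ =>
          Finset.sum_nonneg fun k _ => hZ0 x k ω) hC0]
        exact ENNReal.ofReal_le_ofReal (hout.cost_le_sum hp hω hM Metric.diam_nonneg)
    _ = ∑ x, ∫⁻ ω, ENNReal.ofReal (∑ k ∈ Finset.range (N m ω x), Z x k ω) ∂P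
          + ENNReal.ofReal C := by
        rw [lintegral_add_right _ measurable_const, lintegral_const, measure_univ, mul_one,
          lintegral_ofReal_sum (Z := fun x ω => ∑ k ∈ Finset.range (N m ω x), Z x k ω) _
            (fun x _ => measurable_sum_range_random (hZm x)
              (measurable_arrived_apply hT.measurable m x))
            fun x ω => Finset.sum_nonneg fun k _ => hZ0 x k ω]
    _ ≤ ∑ x, ENNReal.ofReal (m * (2 * q x * r x + δ)) + ENNReal.ofReal (m * δ) := by
        gcongr with x
        exact hm x
    _ = ENNReal.ofReal (m * (2 * ∑ x, q x * r x + ε)) := by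
        rw [← ENNReal.ofReal_sum_of_nonneg fun x _ => hpos x,
          ← ENNReal.ofReal_add (Finset.sum_nonneg fun x _ => hpos x) (by positivity)]
        congr 1
        rw [← Finset.mul_sum, Finset.sum_add_distrib, Finset.mul_sum, Finset.sum_const,
          Finset.card_univ, nsmul_eq_mul]
        have : ε = Fintype.card X * δ + δ := by rw [hδ]; field_simp
        simp only [mul_assoc]
        linear_combination (-(m : ℝ)) * this

/-- The expected offline optimum is at least
`m ((1 - exp (-2)) / 4 * ∑ x, (lam x / lam(X)) min (p, ρ x) - o(1))`. -/
lemma eventually_le_lintegral_opt (hlam : ∀ x, 0 < lam x) (hp : 0 < p)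
    (hT : IsPoissonArrival lam T P) {ε : ℝ} (hε : 0 < ε) :
    ∀ᶠ m : ℕ in atTop,
      ENNReal.ofReal (m * ((1 - Real.exp (-2)) / 4
        * ∑ x, min p (radius lam x) * (lam x / ∑ y, lam y) - ε))
        ≤ ∫⁻ ω, ENNReal.ofReal (opt p (requests (fun x k => T x k ω) m)) ∂P := by
  set q : X → ℝ := fun x => min p (radius lam x) with hq
  have hqpos : ∀ x, 0 < q x := fun x => lt_min hp (radius_pos hlam x)
  have hq0 : ∀ x, 0 ≤ q x := fun x => (hqpos x).le
  set r : X → ℝ := fun x => lam x / ∑ y, lam y with hr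
  set Z : X → ℕ → Ω → ℝ := fun x k ω =>
    nearGap (fun x k => T x k ω) (Metric.ball x (q x)) (q x) x k / 2 with hZ
  set N : ℕ → Ω → X → ℕ := fun m ω => arrived (fun x k => T x k ω) m with hN
  have hexp : Real.exp (-2) ≤ 1 := Real.exp_le_one_iff.2 (by norm_num)
  have hZm : ∀ x k, Measurable (Z x k) := fun x k =>
    (hT.measurable_nearGap _ (q x) x k).div_const 2
  have hZ0 : ∀ x k ω, 0 ≤ Z x k ω := fun x k ω =>
    div_nonneg (nearGap_nonneg _ _ (hq0 x) x k) two_pos.le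
  have hZq : ∀ x k ω, Z x k ω ≤ q x := fun x k ω => by
    have := nearGap_le (fun x k => T x k ω) (Metric.ball x (q x)) (hq0 x) x k
    simp only [hZ]
    linarith [hq0 x]
  have hmean : ∀ x k, ENNReal.ofReal ((1 - Real.exp (-2)) / 4 * q x)
      ≤ ∫⁻ ω, ENNReal.ofReal (Z x k ω) ∂P := by
    intro x k
    have h := hT.le_lintegral_nearGap hlam (Metric.mem_ball_self (hqpos x)) k (hqpos x)
      (rate_ball_min_radius_le hlam hp x)
    have e : ∀ ω, ENNReal.ofReal (Z x k ω) = ENNReal.ofReal (1 / 2) * ENNReal.ofReal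
        (nearGap (fun x k => T x k ω) (Metric.ball x (q x)) (q x) x k) := fun ω => by
      rw [← ENNReal.ofReal_mul (by norm_num)]
      congr 1
      simp only [hZ]; ring
    simp_rw [e]
    rw [lintegral_const_mul _ (hT.measurable_nearGap _ (q x) x k).ennreal_ofReal]
    calc ENNReal.ofReal ((1 - Real.exp (-2)) / 4 * q x)
        = ENNReal.ofReal (1 / 2) * ENNReal.ofReal (q x * (1 - Real.exp (-2)) / 2) := by
          rw [← ENNReal.ofReal_mul (by norm_num)]
          congr 1; ring
      _ ≤ _ := by gcongr
  set δ : ℝ := ε / Fintype.card X with hδ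
  have hcard : (0 : ℝ) < Fintype.card X := by exact_mod_cast Fintype.card_pos
  have hδ0 : 0 < δ := by positivity
  have hsum : ∀ᶠ m : ℕ in atTop, ∀ x,
      ENNReal.ofReal (m * ((1 - Real.exp (-2)) / 4 * q x * r x - δ))
        ≤ ∫⁻ ω, ENNReal.ofReal (∑ k ∈ Finset.range (N m ω x), Z x k ω) ∂P :=
    eventually_all.2 fun x => eventually_le_lintegral_sum
      (N := fun m ω => N m ω x) (fun m => measurable_arrived_apply hT.measurable m x)
      (fun m ω => arrived_le _ m x) (div_sum_nonneg hlam x) (div_sum_le_one hlam x)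
      (hT.ae_tendsto_arrived_div hlam x) (hZm x) (hZ0 x) (hq0 x) (hZq x)
      (mul_nonneg (by linarith) (hq0 x)) (hmean x) hδ0
  filter_upwards [hsum] with m hm
  calc ENNReal.ofReal (m * ((1 - Real.exp (-2)) / 4 * ∑ x, q x * r x - ε))
      = ENNReal.ofReal (∑ x, m * ((1 - Real.exp (-2)) / 4 * q x * r x - δ)) := by
        congr 1
        rw [← Finset.mul_sum, Finset.sum_sub_distrib, Finset.mul_sum, Finset.sum_const,
          Finset.card_univ, nsmul_eq_mul]
        have : ε = Fintype.card X * δ := by rw [hδ]; field_simp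
        simp only [mul_assoc]
        linear_combination (-(m : ℝ)) * this
    -- The summands may be negative, so only subadditivity of `ENNReal.ofReal` is available; it goes
    -- the right way.
    _ ≤ ∑ x, ENNReal.ofReal (m * ((1 - Real.exp (-2)) / 4 * q x * r x - δ)) :=
        Finset.le_sum_of_subadditive _ ENNReal.ofReal_zero.le
          (fun _ _ => ENNReal.ofReal_add_le) _ _
    _ ≤ ∑ x, ∫⁻ ω, ENNReal.ofReal (∑ k ∈ Finset.range (N m ω x), Z x k ω) ∂P :=
        Finset.sum_le_sum fun x _ => hm x
    _ = ∫⁻ ω, ENNReal.ofReal (∑ x, ∑ k ∈ Finset.range (N m ω x), Z x k ω) ∂P :=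
        (lintegral_ofReal_sum (Z := fun x ω => ∑ k ∈ Finset.range (N m ω x), Z x k ω) _
            (fun x _ => measurable_sum_range_random (hZm x)
              (measurable_arrived_apply hT.measurable m x))
            fun x ω => Finset.sum_nonneg fun k _ => hZ0 x k ω).symm
    _ ≤ _ := lintegral_mono fun ω => ENNReal.ofReal_le_ofReal (sum_nearGap_le_opt hp)

end Expectations

end MPMDfp

theorem mainTheorem4 {X : Type*} [PseudoMetricSpace X] [Fintype X] [Nonempty X]
    (lam : X → ℝ) (hlam : ∀ x, 0 < lam x) (p : ℝ) (hp : 0 < p)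
    {Ω : Type*} [MeasurableSpace Ω] (P : Measure Ω) [IsProbabilityMeasure P]
    (T : X → ℕ → Ω → ℝ) (hT : MPMDfp.IsPoissonArrival lam T P)
    (σ : ∀ m : ℕ, Ω → Fin m → MPMDfp.Request X)
    (hσ : ∀ m ω, σ m ω = MPMDfp.requests (fun x k => T x k ω) m)
    (ALG : ∀ m : ℕ, Ω → MPMDfp.Solution m)
    (hALG : ∀ m, ∀ᵐ ω ∂P, MPMDfp.IsOutput p lam (σ m ω) (ALG m ω)) :
    (∀ m, ∀ᵐ ω ∂P, MPMDfp.Feasible (σ m ω) (ALG m ω)) ∧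
    limsup (fun m : ℕ =>
        (∫⁻ ω, ENNReal.ofReal (MPMDfp.cost p (σ m ω) (ALG m ω)) ∂P) /
          (∫⁻ ω, ENNReal.ofReal (MPMDfp.opt p (σ m ω)) ∂P)) atTop
      ≤ ENNReal.ofReal (8 / (1 - Real.exp (-2))) := by
  simp only [hσ] at hALG ⊢
  constructor
  · intro m
    filter_upwards [hT.ae_pos hlam, hALG m] with ω hω hout
    exact hout.feasible hp (MPMDfp.monotone_requests_time hω)
  · set Q : ℝ := ∑ x, min p (MPMDfp.radius lam x) * (lam x / ∑ y, lam y) with hQ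
    -- `Q` is the asymptotic mean of `min p (radius lam x)` per request. It occurs in both bounds
    -- and, being positive, cancels.
    have hQ0 : 0 < Q := Finset.sum_pos (fun x _ => mul_pos
      (lt_min hp (MPMDfp.radius_pos hlam x)) (div_pos (hlam x)
      (Finset.sum_pos (fun y _ => hlam y) Finset.univ_nonempty))) Finset.univ_nonempty
    have hexp : 0 < 1 - Real.exp (-2) := sub_pos.2 (Real.exp_lt_one_iff.2 (by norm_num))
    have h := MPMDfp.limsup_div_le
      (by positivity : 0 < (1 - Real.exp (-2)) / 4 * Q)
      (fun ε hε => MPMDfp.eventually_lintegral_cost_le hlam hp hT hALG hε)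
      fun ε hε => MPMDfp.eventually_le_lintegral_opt hlam hp hT hε
    refine h.trans (le_of_eq ?_)
    rw [← hQ]
    congr 1
    field_simp
    norm_num
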